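/- Let $n>1$ be an integer, let $\Sigma$ be a connected, complete, oriented Riemannian $n$-manifold, smoothly and isometrically immersed in $\mathbb R^{n+1}$, with smooth unit normal field $N$, Riemannian distance $d$ and second fundamental form $A$. We regard $A$ as a linear operator on $T_x\Sigma$ for every $x\in\Sigma$ and write $\|A\|(x)$ for its operator norm. Let $a>0$ and assume: (A1) there is a constant $C_0$ such that $a\|A\|(x)<C_0<1$ for all $x\in\Sigma$; (A2) $\|A\|(x)\to 0$ as $d(x,x_0)\to\infty$, where $x_0\in\Sigma$ is a fixed point. Let $\Omega=\Sigma\times(-a,a)$ be the quantum layer over $\Sigma$, with the Riemannian metric $p^*(ds_E^2)$, where $p:\Omega\to\mathbb R^{n+1}$, $p(x,u)=x+uN(x)$ (here $x$ also denotes the image of $x$ under the immersion) and $ds_E^2$ is the Euclidean metric. Under (A1), $p$ is an immersion, so that $p^*(ds_E^2)$ is a Riemannian metric. Let $\Delta$ and $d\Omega$ be the Laplacian and the Riemannian measure of $\Omega$, and let $$\sigma_{\rm ess}=\sup_{K}\ \inf_{0\neq f\in C_0^\infty(\Omega\setminus K)}\ \frac{-\int_\Omega f\,\Delta f\,d\Omega}{\int_\Omega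 f^2\,d\Omega}\in[0,+\infty],$$ where $K$ runs over all compact subsets of $\Omega$; this is the lower bound of the essential spectrum of the Dirichlet Laplacian of $\Omega$. Then $$\sigma_{\rm ess}\ \ge\ \kappa_1^2=\frac{\pi^2}{4a^2}.$$ -/

import Mathlib

open Set Filter MeasureTheory Bundle Manifold
open scoped ContDiff Topology ENNReal

noncomputable section

/-- The Euclidean space `ℝ^m`. -/
abbrev Euc (m : ℕ) : Type := EuclideanSpace ℝ (Fin m)

namespace QuantumLayer

section Hypersurface

variable {n : ℕ} {S : Type*} [TopologicalSpace S] [ChartedSpace (Euc n) S]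

/-- The differential at `x` of a map from the `n`-manifold `S` to `ℝ^(n+1)`, as a linear map from
`T_x S` to `ℝ^(n+1)`. -/
def differential (F : S → Euc (n + 1)) (x : S) : TangentSpace (𝓡 n) x →L[ℝ] Euc (n + 1) :=
  mfderiv (𝓡 n) 𝓘(ℝ, Euc (n + 1)) F x

variable [RiemannianBundle (fun x : S ↦ TangentSpace (𝓡 n) x)]

/-- `ψ : S → ℝ^(n+1)` is a smooth immersion, the Riemannian metric of `S` is the metric induced
by `ψ`, and `N` is a smooth unit normal field along `ψ` (so `S` is oriented by `N`). -/
structure IsOrientedHypersurface (ψ N : S → Euc (n + 1)) : Prop where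
  contMDiff_immersion : ContMDiff (𝓡 n) 𝓘(ℝ, Euc (n + 1)) ∞ ψ
  isometric : ∀ (x : S) (v w : TangentSpace (𝓡 n) x),
    inner ℝ (differential ψ x v) (differential ψ x w) = inner ℝ v w
  contMDiff_normal : ContMDiff (𝓡 n) 𝓘(ℝ, Euc (n + 1)) ∞ N
  norm_normal : ∀ x : S, ‖N x‖ = 1
  inner_normal : ∀ (x : S) (v : TangentSpace (𝓡 n) x), inner ℝ (differential ψ x v) (N x) = 0

/-- The second fundamental form at `x`, regarded as a linear operator `A` on `T_x S`: it is
characterized by `⟪A v, w⟫ = - ⟪dN v, dψ w⟫`. Its norm `‖A‖ (x)` is the operator norm with respect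
to the Riemannian norm of `T_x S`. -/
def secondFundamentalForm (ψ N : S → Euc (n + 1)) (x : S) :
    TangentSpace (𝓡 n) x →L[ℝ] TangentSpace (𝓡 n) x :=
  haveI : FiniteDimensional ℝ (TangentSpace (𝓡 n) x) :=
    inferInstanceAs (FiniteDimensional ℝ (Euc n))
  haveI : CompleteSpace (TangentSpace (𝓡 n) x) := FiniteDimensional.complete ℝ _
  (-1 : ℝ) • (ContinuousLinearMap.adjoint (differential ψ x)).comp (differential N x)

theorem inner_secondFundamentalForm (ψ N : S → Euc (n + 1)) (x : S)
    (v w : TangentSpace (𝓡 n) x) :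
    inner ℝ (secondFundamentalForm ψ N x v) w
      = -inner ℝ (differential N x v) (differential ψ x w) := by
  have : FiniteDimensional ℝ (TangentSpace (𝓡 n) x) :=
    inferInstanceAs (FiniteDimensional ℝ (Euc n))
  have : CompleteSpace (TangentSpace (𝓡 n) x) := FiniteDimensional.complete ℝ _
  simp [secondFundamentalForm, inner_neg_left, ContinuousLinearMap.adjoint_inner_left]

end Hypersurface

section Coordinates

variable {n : ℕ}

/-- The coordinate frame `∂/∂x_1, …, ∂/∂x_n, ∂/∂u` of `ℝ^n × ℝ`. -/
def coordFrame : Fin n ⊕ Unit → Euc n × ℝ :=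
  Sum.elim (fun i ↦ (EuclideanSpace.single i 1, 0)) (fun _ ↦ (0, 1))

/-- The matrix `G_ij` of the pullback of the Euclidean metric under `P : ℝ^n × ℝ → ℝ^(n+1)`. -/
def metricMatrix (P : Euc n × ℝ → Euc (n + 1)) (q : Euc n × ℝ) :
    Matrix (Fin n ⊕ Unit) (Fin n ⊕ Unit) ℝ :=
  Matrix.of fun i j ↦ inner ℝ (fderiv ℝ P q (coordFrame i)) (fderiv ℝ P q (coordFrame j))

/-- The Laplace-Beltrami operator of the metric `G_ij` in coordinates,
`(det G)^(-1/2) ∑_i ∂_i (∑_j G^ij (det G)^(1/2) ∂_j f)`. -/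
def coordLaplacian (P : Euc n × ℝ → Euc (n + 1)) (f : Euc n × ℝ → ℝ) (q : Euc n × ℝ) : ℝ :=
  (√(metricMatrix P q).det)⁻¹ *
    ∑ i, fderiv ℝ
      (fun r ↦ ∑ j, (metricMatrix P r)⁻¹ i j * √(metricMatrix P r).det *
        fderiv ℝ f r (coordFrame j)) q (coordFrame i)

end Coordinates

section Layer

variable {n : ℕ} {S : Type*} [TopologicalSpace S] [ChartedSpace (Euc n) S]

/-- The map `p (x, u) = x + u N` (with `x` standing for its image under the immersion). -/
def layerMap (ψ N : S → Euc (n + 1)) (z : S × ℝ) : Euc (n + 1) :=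
  ψ z.1 + z.2 • N z.1

variable (S) in
/-- The layer `Ω = S × (-a, a)`, as an open subset of `S × ℝ`. -/
def layer (a : ℝ) : Set (S × ℝ) := univ ×ˢ Ioo (-a) a

/-- The inverse of the standard coordinate system `(x_1, …, x_n, u)` of the layer associated with a
chart `φ` of `S`. -/
def stdCoordSymm (φ : OpenPartialHomeomorph S (Euc n)) (q : Euc n × ℝ) : S × ℝ :=
  (φ.symm q.1, q.2)

/-- The Laplacian of `f` on the layer with the metric `p^*(ds_E^2)`, computed at `z = (x, u)` in the
standard coordinate system given by the preferred chart of `S` at `x`. -/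
def layerLaplacian (ψ N : S → Euc (n + 1)) (f : S × ℝ → ℝ) (z : S × ℝ) : ℝ :=
  coordLaplacian (layerMap ψ N ∘ stdCoordSymm (chartAt (Euc n) z.1))
    (f ∘ stdCoordSymm (chartAt (Euc n) z.1)) (chartAt (Euc n) z.1 z.1, z.2)

variable [MeasurableSpace S]

/-- The measure `(det G)^(1/2) dx_1 … dx_n du` on the part of the layer that is covered by the
standard coordinate system of the chart `φ`, extended by zero. -/
def chartVolume (ψ N : S → Euc (n + 1)) (a : ℝ) (φ : OpenPartialHomeomorph S (Euc n)) :
    Measure (S × ℝ) :=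
  ((volume.restrict (φ.target ×ˢ Ioo (-a) a)).withDensity fun q ↦
    ENNReal.ofReal √(metricMatrix (layerMap ψ N ∘ stdCoordSymm φ) q).det).map (stdCoordSymm φ)

/-- The Riemannian measure `dΩ` of the layer. The measures `chartVolume φ` agree on overlaps of
charts, so their supremum is the measure on `Ω` which restricts to `chartVolume φ` on the domain of
each standard coordinate system. -/
def layerVolume (ψ N : S → Euc (n + 1)) (a : ℝ) : Measure (S × ℝ) :=
  ⨆ φ ∈ atlas (Euc n) S, chartVolume ψ N a φ

/-- `f ∈ C_0^∞ (Ω \ K)`, `f ≠ 0`. -/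
structure IsTestFunction (a : ℝ) (K : Set (S × ℝ)) (f : S × ℝ → ℝ) : Prop where
  contMDiff : ContMDiff ((𝓡 n).prod 𝓘(ℝ, ℝ)) 𝓘(ℝ, ℝ) ∞ f
  hasCompactSupport : HasCompactSupport f
  tsupport_subset : tsupport f ⊆ layer S a \ K
  ne_zero : f ≠ 0

/-- The quotient `(- ∫_Ω f Δf dΩ) / ∫_Ω f^2 dΩ`. -/
def rayleighQuotient (ψ N : S → Euc (n + 1)) (a : ℝ) (f : S × ℝ → ℝ) : ℝ :=
  (-∫ z, f z * layerLaplacian ψ N f z ∂(layerVolume ψ N a)) /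
    ∫ z, f z ^ 2 ∂(layerVolume ψ N a)

/-- The lower bound of the essential spectrum of the Dirichlet Laplacian of the layer,
`σ_ess = sup_K inf_{f ∈ C_0^∞ (Ω \ K)} (- ∫_Ω f Δf) / ∫_Ω f^2` with `K` running over the compact
subsets of `Ω`, as an extended real number (it is `+∞` for instance if `S` is compact). -/
def sigmaEss (ψ N : S → Euc (n + 1)) (a : ℝ) : EReal :=
  ⨆ (K : Set (S × ℝ)) (_ : IsCompact K) (_ : K ⊆ layer S a),
    ⨅ (f : S × ℝ → ℝ) (_ : IsTestFunction (n := n) a K f), (rayleighQuotient ψ N a f : EReal)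

end Layer

end QuantumLayer

end

/-!
# The essential spectrum of a quantum layer

In the standard coordinates `(x, u)` the vector field `∂/∂u` has unit length and is orthogonal to
the slices `u = const`. Hence `|∇f| ^ 2 ≥ (∂f/∂u) ^ 2`, and Green's formula gives
`-∫ f Δf ≥ ∫ (∂f/∂u) ^ 2` (`IsOrientedHypersurface.integral_vderiv_sq_le`). So the spectral bound is
a matter of Poincaré inequalities on the normal segments `{x} × (-a, a)`, with the Riemannian
density as weight (`IsOrientedHypersurface.mul_integral_sq_le_integral_vderiv_sq`).

If `a ‖A‖ (x) ≤ δ < 1`, then on the normal segment through `x` the differential of the layer map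
stretches vectors by factors between `1 - δ` and `1 + δ` relative to `u = 0`, so the density is
between `(1 - δ) ^ (n + 1)` and `(1 + δ) ^ (n + 1)` times its value at `u = 0`
(`IsOrientedHypersurface.sqrt_det_bounds`). An unweighted Poincaré inequality with constant `lam₀`
therefore holds on the segment with the constant `lam₀ ((1 - δ) / (1 + δ)) ^ (n + 1)`.

Let `lam < (π / (2 a)) ^ 2`. Take `δ` so small that this factor, applied to the sharp Dirichlet
constant `(π / (2 a)) ^ 2` of `(-a, a)`, leaves at least `lam`, and let `R` be such that
`a ‖A‖ ≤ δ` outside the ball of radius `R` about `x₀`. Let `K` be the product of the closed ball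
with `[-b, b]`; it is compact because `S` is complete (`properSpace_of_isRiemannianManifold`). For
test functions supported off `K`, segments outside the ball are covered by the sharp inequality. On
segments over the ball the functions live in `b < |u| < a`, where the constant
`(b / (a ^ 2 - b ^ 2)) ^ 2` of `div_sq_mul_integral_sq_le_integral_deriv_sq` is as large as desired
if `b` is close to `a`, and the uniform bound `a ‖A‖ < C₀ < 1` controls the density.

Green's formula has to be proved for the Laplacian as given in coordinates. Its invariance under
changes of charts (`coordLaplacian_comp`) is the Piola identity (`piola`) for the field
`√(det G) ∇f`; a partition of unity on `S` then reduces the formula to the divergence theorem in a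
coordinate domain. In the same way the change of variables formula identifies the supremum of the
chart measures with the Riemannian measure (`IsOrientedHypersurface.layerVolume_restrict_cylinder`).
-/

noncomputable section

namespace QuantumLayer

/-! ### Closed balls in complete Riemannian manifolds -/

/-- Hopf–Rinow–Cohn-Vossen: in a complete, locally compact length space closed balls are compact.
The hypothesis `hX` says that almost-midpoints exist with any prescribed ratio. The supremum `R` of
the radii of compact balls about `x₀` is attained, since the ball of radius `R` is totally bounded,
and then exceeded by local compactness. -/
theorem isCompact_closedBall_of_exists_between {X : Type*} [MetricSpace X] [CompleteSpace X]
    [LocallyCompactSpace X]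
    (hX : ∀ (x y : X) (r s : ℝ), 0 < r → 0 < s → dist x y < r + s →
      ∃ z, dist x z < r ∧ dist z y < s) (x₀ : X) (r : ℝ) :
    IsCompact (Metric.closedBall x₀ r) := by
  by_contra hr
  set A : Set ℝ := {t | IsCompact (Metric.closedBall x₀ t)} with hA
  have hbdd : ∀ t ∈ A, t ≤ r := fun t ht ↦ by
    by_contra! h
    exact hr (ht.of_isClosed_subset Metric.isClosed_closedBall
      (Metric.closedBall_subset_closedBall h.le))
  have h0 : (0 : ℝ) ∈ A := by simp [hA]
  have hbd : BddAbove A := ⟨r, hbdd⟩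
  set R := sSup A with hR
  have hR0 : 0 ≤ R := le_csSup hbd h0
  have hlt : ∀ t < R, IsCompact (Metric.closedBall x₀ t) := fun t ht ↦ by
    obtain ⟨t', ht', htt'⟩ := exists_lt_of_lt_csSup ⟨0, h0⟩ ht
    exact ht'.of_isClosed_subset Metric.isClosed_closedBall
      (Metric.closedBall_subset_closedBall htt'.le)
  have hRc : IsCompact (Metric.closedBall x₀ R) := by
    refine TotallyBounded.isCompact_of_isClosed ?_ Metric.isClosed_closedBall
    rw [Metric.totallyBounded_iff]
    intro ε hε
    -- a net of the ball of radius `R - ε / 4` with mesh `ε / 2` is a net of the ball of radius `R`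
    -- with mesh `ε`
    by_cases hRε : R ≤ ε / 4
    · refine ⟨{x₀}, finite_singleton _, fun y hy ↦ ?_⟩
      simp only [mem_singleton_iff, iUnion_iUnion_eq_left, Metric.mem_ball]
      rw [Metric.mem_closedBall] at hy
      linarith
    · push Not at hRε
      obtain ⟨F, hF, hFc⟩ := Metric.totallyBounded_iff.1
        (hlt (R - ε / 4) (by linarith)).totallyBounded (ε / 2) (by linarith)
      refine ⟨F, hF, fun y hy ↦ ?_⟩
      rw [Metric.mem_closedBall, dist_comm] at hy
      obtain ⟨z, hz1, hz2⟩ := hX x₀ y (R - ε / 4) (ε / 2) (by linarith) (by linarith)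
        (by linarith)
      have hz : z ∈ Metric.closedBall x₀ (R - ε / 4) := by
        rw [Metric.mem_closedBall, dist_comm]; exact hz1.le
      obtain ⟨p, hp, hpz⟩ := mem_iUnion₂.1 (hFc hz)
      refine mem_iUnion₂.2 ⟨p, hp, ?_⟩
      rw [Metric.mem_ball] at hpz ⊢
      have := dist_triangle_left y p z
      linarith
  obtain ⟨K, hK, hRK⟩ := exists_compact_superset hRc
  obtain ⟨δ, hδ, hδK⟩ := hRc.exists_thickening_subset_open isOpen_interior hRK
  have hmem : R + δ / 2 ∈ A := by
    refine hK.of_isClosed_subset Metric.isClosed_closedBall fun y hy ↦ ?_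
    refine interior_subset (hδK ?_)
    rw [Metric.mem_closedBall, dist_comm] at hy
    by_cases hR' : R = 0
    · rw [Metric.mem_thickening_iff]
      refine ⟨x₀, by simp [hR0], ?_⟩
      rw [dist_comm]; linarith
    · obtain ⟨z, hz1, hz2⟩ := hX x₀ y R δ (lt_of_le_of_ne hR0 (Ne.symm hR')) hδ (by linarith)
      rw [Metric.mem_thickening_iff]
      refine ⟨z, ?_, by rw [dist_comm]; exact hz2⟩
      rw [Metric.mem_closedBall, dist_comm]; exact hz1.le
  have := le_csSup hbd hmem
  linarith

/-- A Riemannian manifold is a length space: a point at distance slightly less than `r` from `x` on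
an almost shortest path from `x` to `y` is at distance less than `s` from `y`. -/
theorem exists_between_of_isRiemannianManifold {n : ℕ} {S : Type*} [MetricSpace S]
    [ChartedSpace (Euc n) S] [RiemannianBundle (fun x : S ↦ TangentSpace (𝓡 n) x)]
    [IsRiemannianManifold (𝓡 n) S] (x y : S) (r s : ℝ) (hr : 0 < r) (hs : 0 < s)
    (h : dist x y < r + s) : ∃ z, dist x z < r ∧ dist z y < s := by
  by_cases hxy : dist x y < r
  · exact ⟨y, hxy, by simpa using hs⟩
  push Not at hxy
  have h1 : riemannianEDist (𝓡 n) x y < ENNReal.ofReal (r + s) := by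
    rw [← IsRiemannianManifold.out (I := 𝓡 n), edist_dist]
    exact (ENNReal.ofReal_lt_ofReal_iff (by linarith)).2 h
  obtain ⟨γ, h0, h1, hγ, hl⟩ := exists_lt_of_riemannianEDist_lt h1
  have hle : ∀ a b : ℝ, 0 ≤ a → a ≤ b → b ≤ 1 →
      edist (γ a) (γ b) ≤ pathELength (𝓡 n) γ a b := fun a b ha hab hb ↦ by
    rw [IsRiemannianManifold.out (I := 𝓡 n)]
    exact riemannianEDist_le_pathELength (hγ.mono (Icc_subset_Icc ha hb)) rfl rfl hab
  set L := (pathELength (𝓡 n) γ 0 1).toReal with hLdef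
  have hLtop : pathELength (𝓡 n) γ 0 1 ≠ ⊤ := (hl.trans ENNReal.ofReal_lt_top).ne
  have hL : L < r + s := by
    rw [hLdef, ← ENNReal.ofReal_lt_ofReal_iff (by linarith), ENNReal.ofReal_toReal hLtop]
    exact hl
  obtain ⟨r', hr'1, hr'2⟩ : ∃ r', max (L - s) 0 < r' ∧ r' < r :=
    exists_between (max_lt (by linarith) hr)
  have hr'0 : 0 < r' := (le_max_right _ _).trans_lt hr'1
  have hr'L : L - s < r' := (le_max_left _ _).trans_lt hr'1
  have hcont : ContinuousOn (fun t ↦ dist x (γ t)) (Icc 0 1) :=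
    (continuous_const.dist continuous_id).comp_continuousOn hγ.continuousOn
  obtain ⟨t, ht, htr⟩ := intermediate_value_Icc zero_le_one hcont
    (show r' ∈ Icc (dist x (γ 0)) (dist x (γ 1)) by
      rw [h0, h1, dist_self]; exact ⟨hr'0.le, by linarith⟩)
  refine ⟨γ t, by simpa [htr] using hr'2, ?_⟩
  have hadd := pathELength_add (I := 𝓡 n) (γ := γ) ht.1 ht.2
  have e1 := hle 0 t le_rfl ht.1 ht.2
  have e2 := hle t 1 ht.1 ht.2 le_rfl
  rw [h0, edist_dist] at e1
  rw [h1, edist_dist] at e2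
  have e3 : ENNReal.ofReal (dist x (γ t)) + ENNReal.ofReal (dist (γ t) y) ≤
      ENNReal.ofReal L := by
    rw [hLdef, ENNReal.ofReal_toReal hLtop, ← hadd]
    exact add_le_add e1 e2
  rw [← ENNReal.ofReal_add dist_nonneg dist_nonneg,
    ENNReal.ofReal_le_ofReal_iff ENNReal.toReal_nonneg] at e3
  simp only at htr
  linarith

theorem properSpace_of_isRiemannianManifold {n : ℕ} {S : Type*} [MetricSpace S] [CompleteSpace S]
    [ChartedSpace (Euc n) S] [RiemannianBundle (fun x : S ↦ TangentSpace (𝓡 n) x)]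
    [IsRiemannianManifold (𝓡 n) S] : ProperSpace S :=
  haveI : LocallyCompactSpace S := ChartedSpace.locallyCompactSpace (Euc n) S
  ⟨isCompact_closedBall_of_exists_between
    (exists_between_of_isRiemannianManifold (n := n))⟩

/-! ### One-dimensional Dirichlet inequalities -/

theorem hasCompactSupport_sq {X : Type*} [TopologicalSpace X] {g : X → ℝ}
    (hg : HasCompactSupport g) : HasCompactSupport fun u ↦ g u ^ 2 :=
  hg.mono fun u hu h ↦ hu (by simp [h])

/-- A one-dimensional Poincaré inequality from a Riccati inequality `τ' ≥ τ ^ 2 + lam`: integrate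
`g' ^ 2 - lam g ^ 2 ≥ (g' + τ g) ^ 2 - (τ g ^ 2)'`. -/
theorem mul_integral_sq_le_integral_deriv_sq {V : Set ℝ} {τ τ' : ℝ → ℝ} {lam : ℝ}
    {g : ℝ → ℝ} (hτ : ∀ u ∈ V, HasDerivAt τ (τ' u) u) (hτ' : ∀ u ∈ V, ContinuousAt τ' u)
    (hlam : ∀ u ∈ V, τ u ^ 2 + lam ≤ τ' u) (hg : ContDiff ℝ 1 g) (hgc : HasCompactSupport g)
    (hgV : tsupport g ⊆ V) :
    lam * ∫ u, g u ^ 2 ≤ ∫ u, deriv g u ^ 2 := by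
  have hg' : Continuous (deriv g) := hg.continuous_deriv le_rfl
  have hgd : ∀ u, HasDerivAt g (deriv g u) u := fun u ↦
    (hg.differentiable one_ne_zero u).hasDerivAt
  set k : ℝ → ℝ := fun u ↦ τ u * g u ^ 2 with hk
  set k' : ℝ → ℝ := fun u ↦ τ' u * g u ^ 2 + τ u * (2 * g u * deriv g u) with hk'
  have hsub : ∀ u, u ∉ tsupport g → g u = 0 := fun u hu ↦ image_eq_zero_of_notMem_tsupport hu
  have hkd : ∀ u, HasDerivAt k (k' u) u := fun u ↦ by
    by_cases hu : u ∈ tsupport g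
    · have := (hτ u (hgV hu)).mul ((hgd u).pow 2)
      refine this.congr_deriv ?_
      simp [hk']
    · have h0 : k =ᶠ[𝓝 u] fun _ ↦ 0 := by
        filter_upwards [(isClosed_tsupport g).isOpen_compl.mem_nhds hu] with v hv
        simp [hk, hsub v hv]
      have : k' u = 0 := by simp [hk', hsub u hu]
      rw [this]
      exact (hasDerivAt_const u (0 : ℝ)).congr_of_eventuallyEq h0
  have hkc : HasCompactSupport k := hgc.mono fun u hu h ↦ hu (by
    simp [hk, h])
  have hkc' : HasCompactSupport k' := hgc.mono fun u hu h ↦ hu (by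
    simp [hk', h])
  have hk'c : Continuous k' := by
    refine continuous_iff_continuousAt.2 fun u ↦ ?_
    by_cases hu : u ∈ tsupport g
    · exact ((hτ' u (hgV hu)).mul (hg.continuous.continuousAt.pow 2)).add
        ((hτ u (hgV hu)).continuousAt.mul
          ((continuousAt_const.mul hg.continuous.continuousAt).mul hg'.continuousAt))
    · have h0 : k' =ᶠ[𝓝 u] fun _ ↦ 0 := by
        filter_upwards [(isClosed_tsupport g).isOpen_compl.mem_nhds hu] with v hv
        simp [hk', hsub v hv]
      exact continuousAt_const.congr h0.symm
  have hkcont : Continuous k := continuous_iff_continuousAt.2 fun u ↦ (hkd u).continuousAt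
  have hi' := hk'c.integrable_of_hasCompactSupport (μ := volume) hkc'
  have hint : ∫ u, k' u = 0 := integral_eq_zero_of_hasDerivAt_of_integrable hkd hi'
    (hkcont.integrable_of_hasCompactSupport hkc)
  have hig : Integrable (fun u ↦ g u ^ 2) :=
    (hg.continuous.pow 2).integrable_of_hasCompactSupport
      (hasCompactSupport_sq hgc)
  have hig' : Integrable (fun u ↦ deriv g u ^ 2) :=
    (hg'.pow 2).integrable_of_hasCompactSupport
      (hasCompactSupport_sq hgc.deriv)
  have key : ∫ u, (lam * g u ^ 2 - k' u) ≤ ∫ u, deriv g u ^ 2 := by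
    refine integral_mono ((hig.const_mul _).sub hi') hig' fun u ↦ ?_
    simp only [hk']
    by_cases hu : u ∈ tsupport g
    · have := mul_le_mul_of_nonneg_right (hlam u (hgV hu)) (sq_nonneg (g u))
      nlinarith [sq_nonneg (deriv g u + τ u * g u)]
    · simp [hsub u hu, sq_nonneg]
  rw [integral_sub (hig.const_mul _) hi', integral_const_mul, hint, sub_zero] at key
  exact key

/-- The sharp Dirichlet inequality on `(-a, a)`, from `τ = κ tan (κ u)` with `κ = π / (2 a)`. -/
theorem sq_mul_integral_sq_le_integral_deriv_sq {a : ℝ} (ha : 0 < a) {g : ℝ → ℝ}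
    (hg : ContDiff ℝ 1 g) (hgc : HasCompactSupport g) (hga : tsupport g ⊆ Ioo (-a) a) :
    (Real.pi / (2 * a)) ^ 2 * ∫ u, g u ^ 2 ≤ ∫ u, deriv g u ^ 2 := by
  set κ := Real.pi / (2 * a) with hκ
  have hκ0 : 0 < κ := by positivity
  have hκa : κ * a = Real.pi / 2 := by rw [hκ]; field_simp
  have hcos : ∀ u ∈ Ioo (-a) a, 0 < Real.cos (κ * u) := fun u hu ↦ by
    refine Real.cos_pos_of_mem_Ioo ⟨?_, ?_⟩ <;> nlinarith [hu.1, hu.2]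
  refine mul_integral_sq_le_integral_deriv_sq (τ := fun u ↦ κ * Real.tan (κ * u))
    (τ' := fun u ↦ κ ^ 2 / Real.cos (κ * u) ^ 2) (fun u hu ↦ ?_) (fun u hu ↦ ?_)
    (fun u hu ↦ ?_) hg hgc hga
  · have h1 := (Real.hasDerivAt_tan (hcos u hu).ne').comp u ((hasDerivAt_id u).const_mul κ)
    refine (h1.const_mul κ).congr_deriv ?_
    simp
    ring
  · exact continuousAt_const.div (by fun_prop) (pow_ne_zero _ (hcos u hu).ne')
  · have := hcos u hu
    simp only [Real.tan_eq_sin_div_cos]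
    refine le_of_eq ?_
    field_simp
    exact Real.sin_sq_add_cos_sq _

/-- A Dirichlet inequality near the ends of `(-a, a)`, from `τ = u / (b ^ 2 - u ^ 2)`. It is not
sharp, but its constant tends to infinity as `b → a`. -/
theorem div_sq_mul_integral_sq_le_integral_deriv_sq {a b : ℝ} (hb : 0 < b) (hba : b < a)
    {g : ℝ → ℝ} (hg : ContDiff ℝ 1 g) (hgc : HasCompactSupport g)
    (hga : tsupport g ⊆ Ioo (-a) a \ Icc (-b) b) :
    (b / (a ^ 2 - b ^ 2)) ^ 2 * ∫ u, g u ^ 2 ≤ ∫ u, deriv g u ^ 2 := by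
  have hV : ∀ u ∈ Ioo (-a) a \ Icc (-b) b, b ^ 2 < u ^ 2 ∧ u ^ 2 < a ^ 2 := fun u hu ↦ by
    obtain ⟨⟨h1, h2⟩, h3⟩ := hu
    rw [mem_Icc, ← abs_le, not_le] at h3
    have h4 : |u| < a := abs_lt.2 ⟨h1, h2⟩
    rw [← sq_abs u]
    constructor <;> nlinarith [abs_nonneg u]
  refine mul_integral_sq_le_integral_deriv_sq (τ := fun u ↦ u / (b ^ 2 - u ^ 2))
    (τ' := fun u ↦ (b ^ 2 + u ^ 2) / (b ^ 2 - u ^ 2) ^ 2) (fun u hu ↦ ?_) (fun u hu ↦ ?_)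
    (fun u hu ↦ ?_) hg hgc hga
  · obtain ⟨h1, h2⟩ := hV u hu
    have h3 := (hasDerivAt_id u).div ((hasDerivAt_const u (b ^ 2)).sub (hasDerivAt_pow 2 u))
      (by linarith : b ^ 2 - u ^ 2 ≠ 0)
    refine h3.congr_deriv ?_
    simp
    ring
  · obtain ⟨h1, h2⟩ := hV u hu
    exact ContinuousAt.div (by fun_prop) (by fun_prop) (pow_ne_zero _ (by linarith))
  · obtain ⟨h1, h2⟩ := hV u hu
    have h3 : 0 < u ^ 2 - b ^ 2 := by linarith
    have e : (b ^ 2 - u ^ 2) ^ 2 = (u ^ 2 - b ^ 2) ^ 2 := by ring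
    rw [div_pow, div_pow, e, add_comm (b ^ 2), add_div]
    gcongr

/-- A Poincaré inequality survives the introduction of a weight with values in `[m, M]`, at the cost
of the factor `m / M` in its constant. -/
theorem mul_setIntegral_sq_mul_le_setIntegral_deriv_sq_mul {a m M lam ρ : ℝ} {g w : ℝ → ℝ}
    (hg : ContDiff ℝ 1 g) (hgc : HasCompactSupport g) (hga : tsupport g ⊆ Ioo (-a) a)
    (hw : Continuous w) (hm : 0 ≤ m) (hρ : 0 ≤ ρ) (hmw : ∀ u ∈ Ioo (-a) a, m ≤ w u)
    (hwM : ∀ u ∈ Ioo (-a) a, w u ≤ M) (hlam : ρ * M ≤ m * lam)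
    (h : lam * ∫ u, g u ^ 2 ≤ ∫ u, deriv g u ^ 2) :
    ρ * ∫ u in Ioo (-a) a, g u ^ 2 * w u ≤ ∫ u in Ioo (-a) a, deriv g u ^ 2 * w u := by
  have hg' : Continuous (deriv g) := hg.continuous_deriv le_rfl
  have h0 : ∀ u, u ∉ Ioo (-a) a → g u = 0 := fun u hu ↦
    image_eq_zero_of_notMem_tsupport fun h ↦ hu (hga h)
  have h0' : ∀ u, u ∉ Ioo (-a) a → deriv g u = 0 := fun u hu ↦
    image_eq_zero_of_notMem_tsupport fun h ↦ hu (hga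
      (closure_minimal support_deriv_subset (isClosed_tsupport g) h))
  have hc : HasCompactSupport (fun u ↦ g u ^ 2) :=
    hasCompactSupport_sq hgc
  have hc' : HasCompactSupport (fun u ↦ deriv g u ^ 2) :=
    hasCompactSupport_sq hgc.deriv
  rw [setIntegral_eq_integral_of_forall_compl_eq_zero fun u hu ↦ by simp [h0 u hu],
    setIntegral_eq_integral_of_forall_compl_eq_zero fun u hu ↦ by simp [h0' u hu]]
  have i1 : Integrable (fun u ↦ g u ^ 2) :=
    (hg.continuous.pow 2).integrable_of_hasCompactSupport hc
  have i2 : Integrable (fun u ↦ deriv g u ^ 2) := (hg'.pow 2).integrable_of_hasCompactSupport hc'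
  have i3 : Integrable (fun u ↦ g u ^ 2 * w u) :=
    ((hg.continuous.pow 2).mul hw).integrable_of_hasCompactSupport hc.mul_right
  have i4 : Integrable (fun u ↦ deriv g u ^ 2 * w u) :=
    ((hg'.pow 2).mul hw).integrable_of_hasCompactSupport hc'.mul_right
  calc ρ * ∫ u, g u ^ 2 * w u ≤ ρ * ∫ u, M * g u ^ 2 := by
        refine mul_le_mul_of_nonneg_left (integral_mono i3 (i1.const_mul _) fun u ↦ ?_) hρ
        by_cases hu : u ∈ Ioo (-a) a
        · simpa [mul_comm] using mul_le_mul_of_nonneg_right (hwM u hu) (sq_nonneg (g u))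
        · simp [h0 u hu]
    _ = ρ * M * ∫ u, g u ^ 2 := by rw [integral_const_mul, mul_assoc]
    _ ≤ m * lam * ∫ u, g u ^ 2 :=
        mul_le_mul_of_nonneg_right hlam (integral_nonneg fun u ↦ sq_nonneg _)
    _ ≤ m * ∫ u, deriv g u ^ 2 := by rw [mul_assoc]; exact mul_le_mul_of_nonneg_left h hm
    _ = ∫ u, m * deriv g u ^ 2 := by rw [integral_const_mul]
    _ ≤ ∫ u, deriv g u ^ 2 * w u := by
        refine integral_mono (i2.const_mul _) i4 fun u ↦ ?_
        by_cases hu : u ∈ Ioo (-a) a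
        · simpa [mul_comm] using mul_le_mul_of_nonneg_right (hmw u hu) (sq_nonneg (deriv g u))
        · simp [h0' u hu]

/-! ### The Piola identity -/

theorem isUnit_of_det_ne_zero {E : Type*} [NormedAddCommGroup E] [NormedSpace ℝ E]
    [FiniteDimensional ℝ E] {M : E →L[ℝ] E} (h : M.det ≠ 0) : IsUnit M := by
  let e := ContinuousLinearMap.toContinuousLinearEquivOfDetNeZero M h
  exact ⟨ContinuousLinearEquiv.toUnit e, by ext; rfl⟩

theorem det_ne_zero_of_isUnit {E : Type*} [NormedAddCommGroup E] [NormedSpace ℝ E]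
    {M : E →L[ℝ] E} (h : IsUnit M) : M.det ≠ 0 := by
  obtain ⟨U, rfl⟩ := h
  exact (ContinuousLinearEquiv.unitsEquiv ℝ E U).toLinearEquiv.isUnit_det'.ne_zero

section Piola

variable {E : Type*} [NormedAddCommGroup E] [NormedSpace ℝ E] [FiniteDimensional ℝ E]

/-- In a basis the determinant is a polynomial in the matrix entries. -/
theorem differentiable_continuousLinearMap_det :
    Differentiable ℝ (fun A : E →L[ℝ] E ↦ A.det) := by
  classical
  let b := Module.finBasis ℝ E
  have h : (fun A : E →L[ℝ] E ↦ A.det) = fun A : E →L[ℝ] E ↦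
      ∑ σ : Equiv.Perm (Fin (Module.finrank ℝ E)), (Equiv.Perm.sign σ : ℤ) •
        ∏ i, b.repr (A (b i)) (σ i) := by
    ext A
    change LinearMap.det (A : E →ₗ[ℝ] E) = _
    rw [← LinearMap.det_toMatrix b, Matrix.det_apply]
    simp [LinearMap.toMatrix_apply, Units.smul_def]
  rw [h]
  refine Differentiable.fun_sum fun σ _ ↦ ?_
  simp only [zsmul_eq_mul]
  refine (differentiable_const _).mul ?_
  intro A
  refine (contDiff_prod (n := 1) fun i _ ↦ ?_).differentiable one_ne_zero A
  let ℓ : E →L[ℝ] ℝ := LinearMap.toContinuousLinearMap (b.coord (σ i))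
  exact (ℓ.comp (ContinuousLinearMap.apply ℝ E (b i))).contDiff

/-- The linear functional `H ↦ det U * tr (U⁻¹ H)` of Jacobi's formula. -/
def detDeriv (U : (E →L[ℝ] E)ˣ) : (E →L[ℝ] E) →L[ℝ] ℝ :=
  (U : E →L[ℝ] E).det •
    (LinearMap.toContinuousLinearMap ((LinearMap.trace ℝ E).comp
      (ContinuousLinearMap.coeLM ℝ (M := E) (N₃ := E)))).comp
        (ContinuousLinearMap.mul ℝ (E →L[ℝ] E) ((U⁻¹ : (E →L[ℝ] E)ˣ) : E →L[ℝ] E))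

theorem detDeriv_apply (U : (E →L[ℝ] E)ˣ) (H : E →L[ℝ] E) :
    detDeriv U H = (U : E →L[ℝ] E).det *
      LinearMap.trace ℝ E (((U⁻¹ : (E →L[ℝ] E)ˣ) * H : E →L[ℝ] E) : E →ₗ[ℝ] E) := rfl

/-- Jacobi's formula: the derivative of the determinant at an invertible operator. -/
theorem hasFDerivAt_det (U : (E →L[ℝ] E)ˣ) :
    HasFDerivAt (fun A : E →L[ℝ] E ↦ A.det) (detDeriv U) (U : E →L[ℝ] E) := by
  classical
  let b := Module.finBasis ℝ E
  have hd := (differentiable_continuousLinearMap_det (E := E) U).hasFDerivAt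
  convert hd using 1
  ext H
  rw [detDeriv_apply]
  have h1 : HasDerivAt (fun t : ℝ ↦ ((U : E →L[ℝ] E) + t • H).det)
      (fderiv ℝ (fun A : E →L[ℝ] E ↦ A.det) (U : E →L[ℝ] E) H) 0 := by
    have h2 : HasDerivAt (fun t : ℝ ↦ (U : E →L[ℝ] E) + t • H) H 0 := by
      simpa using ((hasDerivAt_id (0 : ℝ)).smul_const H).const_add (U : E →L[ℝ] E)
    have hd' : HasFDerivAt (fun A : E →L[ℝ] E ↦ A.det)
        (fderiv ℝ (fun A : E →L[ℝ] E ↦ A.det) (U : E →L[ℝ] E))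
        ((U : E →L[ℝ] E) + (0 : ℝ) • H) := by simpa using hd
    exact hd'.comp_hasDerivAt (0 : ℝ) h2
  set K : E →L[ℝ] E := ((U⁻¹ : (E →L[ℝ] E)ˣ) : E →L[ℝ] E) * H with hK
  set M := LinearMap.toMatrix b b (K : E →ₗ[ℝ] E) with hM
  -- `det (U + t H) = det U * det (1 + t U⁻¹ H)`, a polynomial in `t` with linear coefficient
  -- `det U * tr (U⁻¹ H)`
  have hfac : ∀ t : ℝ, ((U : E →L[ℝ] E) + t • H).det =
      (U : E →L[ℝ] E).det * (1 + Matrix.trace M * t +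
        ((1 + (Polynomial.X : Polynomial ℝ) • M.map Polynomial.C).det).divX.divX.eval t
          * t ^ 2) := fun t ↦ by
    rw [← Matrix.det_one_add_smul]
    have e : (U : E →L[ℝ] E) + t • H = (U : E →L[ℝ] E) * (1 + t • K) := by
      rw [hK, mul_add, mul_one, mul_smul_comm, ← mul_assoc, Units.mul_inv, one_mul]
    rw [e]
    change LinearMap.det (((U : E →L[ℝ] E) : E →ₗ[ℝ] E) *
      ((1 + t • K : E →L[ℝ] E) : E →ₗ[ℝ] E)) = _
    rw [map_mul]
    congr 1
    rw [← LinearMap.det_toMatrix b]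
    congr 1
    rw [hM, show ((1 + t • K : E →L[ℝ] E) : E →ₗ[ℝ] E) = LinearMap.id + t • (K : E →ₗ[ℝ] E)
      from rfl, map_add, map_smul, LinearMap.toMatrix_id]
  have h3 : HasDerivAt (fun t : ℝ ↦ ((U : E →L[ℝ] E) + t • H).det)
      ((U : E →L[ℝ] E).det * Matrix.trace M) 0 := by
    simp_rw [hfac]
    set p := ((1 + (Polynomial.X : Polynomial ℝ) • M.map Polynomial.C).det).divX.divX
    have h4 := (((hasDerivAt_id (0 : ℝ)).const_mul (Matrix.trace M)).const_add 1).add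
      ((p.hasDerivAt 0).mul (hasDerivAt_pow 2 (0 : ℝ)))
    refine (h4.const_mul ((U : E →L[ℝ] E).det)).congr_deriv ?_
    simp
  rw [LinearMap.trace_eq_matrix_trace ℝ b]
  exact h3.unique h1

/-- The Piola identity: the pull-back `|det DT| (DT)⁻¹ (V ∘ T)` of the vector field `V` as a vector
density has divergence `|det DT| (div V) ∘ T`. The terms with second derivatives of `T` coming from
`|det DT|` and from `(DT)⁻¹` cancel, because `D²T` is symmetric. It is stated as differentiability
of the pull-back with a derivative of the right trace. -/
theorem piola {T V : E → E} {q : E} (hT : ContDiffAt ℝ 2 T q)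
    (hU : IsUnit (fderiv ℝ T q)) (hV : DifferentiableAt ℝ V (T q)) :
    ∃ A : E →L[ℝ] E,
      HasFDerivAt (fun r ↦ |(fderiv ℝ T r).det| • Ring.inverse (fderiv ℝ T r) (V (T r))) A q ∧
      LinearMap.trace ℝ E (A : E →ₗ[ℝ] E) =
        |(fderiv ℝ T q).det| * LinearMap.trace ℝ E (fderiv ℝ V (T q) : E →ₗ[ℝ] E) := by
  obtain ⟨U, hUq⟩ := hU
  have hCE : CompleteSpace E := FiniteDimensional.complete ℝ E
  set D' := fderiv ℝ (fderiv ℝ T) q with hD'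
  have hDT : HasFDerivAt (fderiv ℝ T) D' q :=
    ((hT.fderiv_right (m := 1) (by norm_num)).differentiableAt one_ne_zero).hasFDerivAt
  have hsymm : ∀ h k, D' h k = D' k h := fun h k ↦
    (hT.isSymmSndFDerivAt (by simp)) h k
  have hTd : HasFDerivAt T (U : E →L[ℝ] E) q := by
    rw [hUq]; exact (hT.differentiableAt two_ne_zero).hasFDerivAt
  have hVT : HasFDerivAt (fun r ↦ V (T r)) ((fderiv ℝ V (T q)).comp (U : E →L[ℝ] E)) q :=
    hV.hasFDerivAt.comp q hTd
  have hdet0 : (U : E →L[ℝ] E).det ≠ 0 := det_ne_zero_of_isUnit U.isUnit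
  have h1 : HasFDerivAt (fun r ↦ (fderiv ℝ T r).det) ((detDeriv U).comp D') q :=
    HasFDerivAt.comp q (g := fun A : E →L[ℝ] E ↦ A.det) (by rw [← hUq]; exact hasFDerivAt_det U)
      hDT
  have h2 : HasFDerivAt (fun r ↦ |(fderiv ℝ T r).det|)
      ((SignType.sign (U : E →L[ℝ] E).det : ℝ) • (detDeriv U).comp D') q := by
    have := (hasDerivAt_abs hdet0)
    rw [hUq] at this
    rw [hUq]
    exact this.comp_hasFDerivAt q h1
  have h3 : HasFDerivAt (fun r ↦ Ring.inverse (fderiv ℝ T r))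
      ((-ContinuousLinearMap.mulLeftRight ℝ (E →L[ℝ] E) ((U⁻¹ : (E →L[ℝ] E)ˣ) : E →L[ℝ] E)
        ((U⁻¹ : (E →L[ℝ] E)ˣ) : E →L[ℝ] E)).comp D') q :=
    HasFDerivAt.comp q (g := Ring.inverse)
      (by rw [← hUq]; exact hasFDerivAt_ringInverse (𝕜 := ℝ) U) hDT
  have h4 := h3.clm_apply hVT
  have h5 := h2.smul h4
  refine ⟨_, h5, ?_⟩
  set y := ((U⁻¹ : (E →L[ℝ] E)ˣ) : E →L[ℝ] E) (V (T q)) with hy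
  set Ui := ((U⁻¹ : (E →L[ℝ] E)ˣ) : E →L[ℝ] E) with hUi
  set s : ℝ := (SignType.sign (U : E →L[ℝ] E).det : ℝ) with hs
  have hsd : s * (U : E →L[ℝ] E).det = |(U : E →L[ℝ] E).det| := sign_mul_self _
  have hinv : Ring.inverse (fderiv ℝ T q) = Ui := by rw [← hUq, Ring.inverse_unit]
  rw [← hUq] at h5 ⊢
  -- symmetry of `D²T` brings the derivative of the inverse into the form `-U⁻¹ (D²T y)`
  have e : ((|(U : E →L[ℝ] E).det| • ((Ring.inverse (fderiv ℝ T q)).comp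
        ((fderiv ℝ V (T q)).comp (U : E →L[ℝ] E)) +
          ContinuousLinearMap.flip ((-ContinuousLinearMap.mulLeftRight ℝ (E →L[ℝ] E) Ui Ui).comp D')
            (V (T q))) +
        ContinuousLinearMap.smulRight (s • (detDeriv U).comp D') y : E →L[ℝ] E) : E →ₗ[ℝ] E)
      = |(U : E →L[ℝ] E).det| • ((Ui : E →ₗ[ℝ] E) * (fderiv ℝ V (T q) : E →ₗ[ℝ] E) *
          ((U : E →L[ℝ] E) : E →ₗ[ℝ] E) - ((Ui * D' y : E →L[ℝ] E) : E →ₗ[ℝ] E)) +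
        (LinearMap.smulRight ((s • (detDeriv U).comp D' : E →L[ℝ] ℝ) : E →ₗ[ℝ] ℝ) y) := by
    ext h
    simp [hinv, hsymm y h, ← hy, sub_eq_add_neg]
  have e' := congrArg (LinearMap.trace ℝ E) e
  have e2 : LinearMap.trace ℝ E ((Ui : E →ₗ[ℝ] E) * (fderiv ℝ V (T q) : E →ₗ[ℝ] E) *
          ((U : E →L[ℝ] E) : E →ₗ[ℝ] E)) = LinearMap.trace ℝ E (fderiv ℝ V (T q) : E →ₗ[ℝ] E) := by
    rw [LinearMap.trace_mul_comm, ← mul_assoc]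
    congr 1
    ext x
    exact congrArg (fun L : E →L[ℝ] E ↦ L (fderiv ℝ V (T q) x)) U.mul_inv
  rw [map_add, map_smul, map_sub, e2, LinearMap.trace_smulRight] at e'
  rw [← hinv] at hy
  have hy' : Ring.inverse (U : E →L[ℝ] E) (V (T q)) = y := by rw [hUq, ← hy]
  -- by Jacobi's formula this cancels the trace of `-U⁻¹ (D²T y)`
  have e3 : (s • (detDeriv U).comp D' : E →L[ℝ] ℝ) y =
      |(U : E →L[ℝ] E).det| * LinearMap.trace ℝ E ((Ui * D' y : E →L[ℝ] E) : E →ₗ[ℝ] E) := by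
    change s * detDeriv U (D' y) = _
    rw [detDeriv_apply, ← mul_assoc, hsd]
  rw [show ((s • (detDeriv U).comp D' : E →L[ℝ] ℝ) : E →ₗ[ℝ] ℝ) y = _ from e3] at e'
  rw [hUq] at e' ⊢
  simp only [hinv] at e' hy ⊢
  rw [← hy]
  refine e'.trans ?_
  simp only [smul_eq_mul]
  ring

end Piola

/-! ### Gram matrices of the coordinate frame -/

section Gram

variable {n : ℕ}

/-- The coordinate frame as a basis of `ℝ^n × ℝ`. -/
def coordBasis (n : ℕ) : Module.Basis (Fin n ⊕ Unit) ℝ (Euc n × ℝ) :=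
  ((EuclideanSpace.basisFun (Fin n) ℝ).toBasis).prod (Module.Basis.singleton Unit ℝ)

@[simp] theorem coordBasis_apply (i : Fin n ⊕ Unit) : coordBasis n i = coordFrame i := by
  rcases i with i | i <;> simp [coordBasis, coordFrame, Module.Basis.prod_apply]

/-- The standard orthonormal basis of `ℝ^(n+1)`, indexed like the coordinate frame of
`ℝ^n × ℝ`. -/
def targetBasis (n : ℕ) : OrthonormalBasis (Fin n ⊕ Unit) ℝ (Euc (n + 1)) :=
  (EuclideanSpace.basisFun (Fin (n + 1)) ℝ).reindex (Fintype.equivOfCardEq (by simp))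

/-- The Gram matrix of the images of the coordinate frame. -/
def gram (L : Euc n × ℝ →L[ℝ] Euc (n + 1)) : Matrix (Fin n ⊕ Unit) (Fin n ⊕ Unit) ℝ :=
  Matrix.of fun i j ↦ inner ℝ (L (coordFrame i)) (L (coordFrame j))

theorem metricMatrix_eq_gram (P : Euc n × ℝ → Euc (n + 1)) (q : Euc n × ℝ) :
    metricMatrix P q = gram (fderiv ℝ P q) := rfl

/-- The square matrix of a linear map `ℝ^n × ℝ → ℝ^(n+1)`. -/
def jac (L : Euc n × ℝ →L[ℝ] Euc (n + 1)) : Matrix (Fin n ⊕ Unit) (Fin n ⊕ Unit) ℝ :=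
  LinearMap.toMatrix (coordBasis n) (targetBasis n).toBasis (L : Euc n × ℝ →ₗ[ℝ] Euc (n + 1))

theorem gram_eq (L : Euc n × ℝ →L[ℝ] Euc (n + 1)) : gram L = (jac L).transpose * jac L := by
  ext i j
  rw [Matrix.mul_apply]
  simp only [gram, jac, Matrix.of_apply, Matrix.transpose_apply, LinearMap.toMatrix_apply,
    coordBasis_apply, OrthonormalBasis.coe_toBasis_repr_apply, OrthonormalBasis.repr_apply_apply]
  rw [← (targetBasis n).sum_inner_mul_inner]
  refine Finset.sum_congr rfl fun k _ ↦ ?_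
  simp [real_inner_comm]

theorem det_gram (L : Euc n × ℝ →L[ℝ] Euc (n + 1)) : (gram L).det = (jac L).det ^ 2 := by
  rw [gram_eq, Matrix.det_mul, Matrix.det_transpose, sq]

theorem sqrt_det_gram (L : Euc n × ℝ →L[ℝ] Euc (n + 1)) : √(gram L).det = |(jac L).det| := by
  rw [det_gram, Real.sqrt_sq_eq_abs]

theorem finrank_prod_eq (n : ℕ) :
    Module.finrank ℝ (Euc n × ℝ) = Module.finrank ℝ (Euc (n + 1)) := by simp

theorem det_jac_ne_zero {L : Euc n × ℝ →L[ℝ] Euc (n + 1)} (hL : Function.Injective L) :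
    (jac L).det ≠ 0 := by
  let e : (Euc n × ℝ) ≃ₗ[ℝ] Euc (n + 1) :=
    LinearEquiv.ofInjectiveOfFinrankEq (L : Euc n × ℝ →ₗ[ℝ] Euc (n + 1)) hL (finrank_prod_eq n)
  have h : (jac L).det = (LinearMap.toMatrix (coordBasis n) (targetBasis n).toBasis
      (e : Euc n × ℝ →ₗ[ℝ] Euc (n + 1))).det := rfl
  rw [h]
  exact (LinearEquiv.isUnit_det e (coordBasis n) (targetBasis n).toBasis).ne_zero

theorem det_gram_pos {L : Euc n × ℝ →L[ℝ] Euc (n + 1)} (hL : Function.Injective L) :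
    0 < (gram L).det := by
  rw [det_gram]
  have := det_jac_ne_zero hL
  positivity

theorem jac_comp (L : Euc n × ℝ →L[ℝ] Euc (n + 1)) (M : Euc n × ℝ →L[ℝ] Euc n × ℝ) :
    jac (L.comp M) = jac L * LinearMap.toMatrix (coordBasis n) (coordBasis n)
      (M : Euc n × ℝ →ₗ[ℝ] Euc n × ℝ) := by
  rw [jac, jac, ← LinearMap.toMatrix_comp]
  rfl

/-- The Riemannian density transforms by the Jacobian determinant. -/
theorem sqrt_det_gram_comp (L : Euc n × ℝ →L[ℝ] Euc (n + 1)) (M : Euc n × ℝ →L[ℝ] Euc n × ℝ) :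
    √(gram (L.comp M)).det = |M.det| * √(gram L).det := by
  rw [sqrt_det_gram, sqrt_det_gram, jac_comp, Matrix.det_mul, abs_mul, LinearMap.det_toMatrix,
    mul_comm]

theorem gram_comp (L : Euc n × ℝ →L[ℝ] Euc (n + 1)) (M : Euc n × ℝ →L[ℝ] Euc n × ℝ) :
    gram (L.comp M) = (LinearMap.toMatrix (coordBasis n) (coordBasis n)
      (M : Euc n × ℝ →ₗ[ℝ] Euc n × ℝ)).transpose * gram L *
      LinearMap.toMatrix (coordBasis n) (coordBasis n) (M : Euc n × ℝ →ₗ[ℝ] Euc n × ℝ) := by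
  rw [gram_eq, gram_eq, jac_comp, Matrix.transpose_mul]
  simp only [Matrix.mul_assoc]

/-- A linear map that expands no vector by more than the factor `c` expands volume by at most
`c ^ dim`: compare the measures of the unit ball and of its image. -/
theorem abs_det_le_pow {F : Type*} [NormedAddCommGroup F] [NormedSpace ℝ F]
    [FiniteDimensional ℝ F] {K : F →ₗ[ℝ] F} {c : ℝ} (hc : 0 ≤ c) (h : ∀ v, ‖K v‖ ≤ c * ‖v‖) :
    |LinearMap.det K| ≤ c ^ Module.finrank ℝ F := by
  borelize F
  let μ : Measure F := Measure.addHaar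
  have h1 : K '' Metric.closedBall 0 1 ⊆ Metric.closedBall 0 c := by
    rintro _ ⟨v, hv, rfl⟩
    rw [mem_closedBall_zero_iff] at hv ⊢
    exact (h v).trans (by simpa using mul_le_mul_of_nonneg_left hv hc)
  have h2 := measure_mono (μ := μ) h1
  rw [Measure.addHaar_image_linearMap, Measure.addHaar_closedBall' _ _ hc] at h2
  have h3 : μ (Metric.closedBall 0 1) ≠ 0 := (Metric.measure_closedBall_pos μ 0 one_pos).ne'
  have h4 : μ (Metric.closedBall 0 1) ≠ ⊤ := measure_closedBall_lt_top.ne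
  rw [ENNReal.mul_le_mul_iff_left h3 h4,
    ENNReal.ofReal_le_ofReal_iff (pow_nonneg hc _)] at h2
  exact h2

/-- Comparison of densities: `L` differs from `L₀` by an operator of norm at most `c` on
`ℝ^(n+1)`. -/
theorem sqrt_det_gram_le {L L₀ : Euc n × ℝ →L[ℝ] Euc (n + 1)} (hL₀ : Function.Injective L₀)
    {c : ℝ} (hc : 0 ≤ c) (h : ∀ v, ‖L v‖ ≤ c * ‖L₀ v‖) :
    √(gram L).det ≤ c ^ (n + 1) * √(gram L₀).det := by
  let e : (Euc n × ℝ) ≃ₗ[ℝ] Euc (n + 1) :=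
    LinearEquiv.ofInjectiveOfFinrankEq (L₀ : Euc n × ℝ →ₗ[ℝ] Euc (n + 1)) hL₀ (finrank_prod_eq n)
  have he : ∀ v, e v = L₀ v := fun v ↦ rfl
  set K : Euc (n + 1) →ₗ[ℝ] Euc (n + 1) :=
    (L : Euc n × ℝ →ₗ[ℝ] Euc (n + 1)).comp (e.symm : Euc (n + 1) →ₗ[ℝ] Euc n × ℝ) with hK
  have h1 : |LinearMap.det K| ≤ c ^ (n + 1) := by
    have := abs_det_le_pow (K := K) hc fun v ↦ by
      have := h (e.symm v)
      rwa [← he, e.apply_symm_apply] at this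
    simpa using this
  have h2 : jac L = LinearMap.toMatrix (targetBasis n).toBasis (targetBasis n).toBasis K *
      jac L₀ := by
    rw [jac, jac, ← LinearMap.toMatrix_comp]
    congr 1
    ext1 <;> ext v <;> simp [hK, ← he]
  rw [sqrt_det_gram, sqrt_det_gram, h2, Matrix.det_mul, abs_mul, LinearMap.det_toMatrix]
  exact mul_le_mul_of_nonneg_right h1 (abs_nonneg _)

/-- Cauchy–Schwarz: the squared gradient bounds the square of the derivative along a unit frame
vector. -/
theorem sq_le_dotProduct_gram_inv {L : Euc n × ℝ →L[ℝ] Euc (n + 1)} (hL : Function.Injective L)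
    {e : Fin n ⊕ Unit} (he : ‖L (coordFrame e)‖ = 1) (v : Fin n ⊕ Unit → ℝ) :
    v e ^ 2 ≤ v ⬝ᵥ ((gram L)⁻¹.mulVec v) := by
  have hdet : IsUnit (gram L).det := (det_gram_pos hL).ne'.isUnit
  set w := (gram L)⁻¹.mulVec v with hw
  have hv : v = (gram L).mulVec w := by
    rw [hw, Matrix.mulVec_mulVec, Matrix.mul_nonsing_inv _ hdet, Matrix.one_mulVec]
  set y : Euc (n + 1) := ∑ j, w j • L (coordFrame j) with hy
  have h1 : ∀ i, v i = inner ℝ (L (coordFrame i)) y := fun i ↦ by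
    rw [hv, hy, inner_sum]
    simp only [Matrix.mulVec, dotProduct, gram, Matrix.of_apply, inner_smul_right]
    exact Finset.sum_congr rfl fun j _ ↦ mul_comm _ _
  have h2 : v ⬝ᵥ w = ‖y‖ ^ 2 := by
    rw [← real_inner_self_eq_norm_sq]
    conv_rhs => rw [hy, sum_inner]
    simp only [dotProduct, inner_smul_left, h1]
    exact Finset.sum_congr rfl fun j _ ↦ by rw [conj_trivial, mul_comm]
  rw [h2, h1 e, sq_le_sq, abs_norm]
  exact (abs_real_inner_le_norm _ _).trans (by rw [he, one_mul])

end Gram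

/-! ### The Laplace–Beltrami operator in coordinates -/

section Flux

variable {n : ℕ}

/-- The components of the vector field `√(det G) ∇f`. -/
def flux (P : Euc n × ℝ → Euc (n + 1)) (f : Euc n × ℝ → ℝ) (r : Euc n × ℝ)
    (i : Fin n ⊕ Unit) : ℝ :=
  ∑ j, (metricMatrix P r)⁻¹ i j * √(metricMatrix P r).det * fderiv ℝ f r (coordFrame j)

theorem coordLaplacian_eq (P : Euc n × ℝ → Euc (n + 1)) (f : Euc n × ℝ → ℝ) (q : Euc n × ℝ) :
    coordLaplacian P f q =
      (√(metricMatrix P q).det)⁻¹ * ∑ i, fderiv ℝ (fun r ↦ flux P f r i) q (coordFrame i) := rfl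

/-- The components of the differential of `f`. -/
def dcoord (f : Euc n × ℝ → ℝ) (r : Euc n × ℝ) (i : Fin n ⊕ Unit) : ℝ :=
  fderiv ℝ f r (coordFrame i)

theorem flux_eq_mulVec (P : Euc n × ℝ → Euc (n + 1)) (f : Euc n × ℝ → ℝ) (r : Euc n × ℝ) :
    flux P f r = √(metricMatrix P r).det • (metricMatrix P r)⁻¹.mulVec (dcoord f r) := by
  ext i
  simp only [flux, Pi.smul_apply, Matrix.mulVec, dotProduct, dcoord, smul_eq_mul, Finset.mul_sum]
  exact Finset.sum_congr rfl fun j _ ↦ by ring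

theorem eventually_differentiableAt {X Y : Type*} [NormedAddCommGroup X] [NormedSpace ℝ X]
    [NormedAddCommGroup Y] [NormedSpace ℝ Y] {f : X → Y} {q : X} (hf : ContDiffAt ℝ ∞ f q) :
    ∀ᶠ r in 𝓝 q, DifferentiableAt ℝ f r := by
  have h1 : ContDiffAt ℝ 1 f q := hf.of_le (by simp)
  filter_upwards [h1.eventually (by simp)] with r hr
  exact hr.differentiableAt one_ne_zero

theorem contDiffAt_det {ι : Type*} [Fintype ι] [DecidableEq ι] {X : Type*} [NormedAddCommGroup X]
    [NormedSpace ℝ X] {A : X → Matrix ι ι ℝ} {q : X} {m : ℕ∞ω}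
    (hA : ∀ i j, ContDiffAt ℝ m (fun x ↦ A x i j) q) : ContDiffAt ℝ m (fun x ↦ (A x).det) q := by
  simp only [Matrix.det_apply']
  exact ContDiffAt.sum fun σ _ ↦ contDiffAt_const.mul (contDiffAt_prod fun i _ ↦ hA _ _)

/-- By Cramer's rule. -/
theorem contDiffAt_inv_matrix {ι : Type*} [Fintype ι] [DecidableEq ι] {X : Type*}
    [NormedAddCommGroup X] [NormedSpace ℝ X] {A : X → Matrix ι ι ℝ} {q : X} {m : ℕ∞ω}
    (hA : ∀ i j, ContDiffAt ℝ m (fun x ↦ A x i j) q) (h0 : (A q).det ≠ 0) (i j : ι) :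
    ContDiffAt ℝ m (fun x ↦ (A x)⁻¹ i j) q := by
  simp only [Matrix.inv_def, Matrix.smul_apply, Ring.inverse_eq_inv', smul_eq_mul,
    Matrix.adjugate_apply]
  refine ((contDiffAt_det hA).inv h0).mul (contDiffAt_det fun k l ↦ ?_)
  by_cases hk : k = j
  · subst hk
    simp only [Matrix.updateRow_self]
    exact contDiffAt_const
  · simpa [Matrix.updateRow_ne hk] using hA k l

theorem contDiffAt_metricMatrix {P : Euc n × ℝ → Euc (n + 1)} {q : Euc n × ℝ}
    (hP : ContDiffAt ℝ ∞ P q) (i j : Fin n ⊕ Unit) :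
    ContDiffAt ℝ ∞ (fun r ↦ metricMatrix P r i j) q := by
  have h : ContDiffAt ℝ ∞ (fderiv ℝ P) q := hP.fderiv_right (by norm_num)
  simp only [metricMatrix, Matrix.of_apply]
  exact (h.clm_apply contDiffAt_const).inner ℝ (h.clm_apply contDiffAt_const)

theorem contDiffAt_sqrt_det {P : Euc n × ℝ → Euc (n + 1)} {q : Euc n × ℝ}
    (hP : ContDiffAt ℝ ∞ P q) (h0 : (metricMatrix P q).det ≠ 0) :
    ContDiffAt ℝ ∞ (fun r ↦ √(metricMatrix P r).det) q :=
  (contDiffAt_det (contDiffAt_metricMatrix hP)).sqrt h0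

theorem contDiffAt_flux {P : Euc n × ℝ → Euc (n + 1)} {f : Euc n × ℝ → ℝ} {q : Euc n × ℝ}
    (hP : ContDiffAt ℝ ∞ P q) (hf : ContDiffAt ℝ ∞ f q) (h0 : (metricMatrix P q).det ≠ 0)
    (i : Fin n ⊕ Unit) : ContDiffAt ℝ ∞ (fun r ↦ flux P f r i) q := by
  have h : ContDiffAt ℝ ∞ (fderiv ℝ f) q := hf.fderiv_right (by norm_num)
  exact ContDiffAt.sum fun j _ ↦ ((contDiffAt_inv_matrix (contDiffAt_metricMatrix hP) h0 i j).mul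
    (contDiffAt_sqrt_det hP h0)).mul (h.clm_apply contDiffAt_const)

theorem differentiableAt_flux {P : Euc n × ℝ → Euc (n + 1)} {f : Euc n × ℝ → ℝ} {q : Euc n × ℝ}
    (hP : ContDiffAt ℝ ∞ P q) (hf : ContDiffAt ℝ ∞ f q) (h0 : (metricMatrix P q).det ≠ 0)
    (i : Fin n ⊕ Unit) : DifferentiableAt ℝ (fun r ↦ flux P f r i) q :=
  (contDiffAt_flux hP hf h0 i).differentiableAt (by simp)

theorem continuousAt_coordLaplacian {P : Euc n × ℝ → Euc (n + 1)} {f : Euc n × ℝ → ℝ}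
    {q : Euc n × ℝ} (hP : ContDiffAt ℝ ∞ P q) (hf : ContDiffAt ℝ ∞ f q)
    (h0 : (metricMatrix P q).det ≠ 0) : ContinuousAt (coordLaplacian P f) q := by
  have h1 := (contDiffAt_sqrt_det hP h0).continuousAt
  have h2 : √(metricMatrix P q).det ≠ 0 := by
    rw [metricMatrix_eq_gram, sqrt_det_gram]
    rw [metricMatrix_eq_gram, det_gram] at h0
    simpa using h0
  refine (h1.inv₀ h2).mul (tendsto_finsetSum _ fun i _ ↦ ?_)
  have h3 : ContDiffAt ℝ ∞ (fderiv ℝ (fun r ↦ flux P f r i)) q :=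
    (contDiffAt_flux hP hf h0 i).fderiv_right (by norm_num)
  exact (h3.clm_apply contDiffAt_const).continuousAt

theorem coordLaplacian_congr {P P' : Euc n × ℝ → Euc (n + 1)} {f f' : Euc n × ℝ → ℝ}
    {q : Euc n × ℝ} (hP : P =ᶠ[𝓝 q] P') (hf : f =ᶠ[𝓝 q] f') :
    coordLaplacian P f q = coordLaplacian P' f' q := by
  have hm : ∀ᶠ r in 𝓝 q, metricMatrix P r = metricMatrix P' r := by
    filter_upwards [hP.eventually_nhds] with r hr
    rw [metricMatrix_eq_gram, metricMatrix_eq_gram, EventuallyEq.fderiv_eq hr]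
  have hfl : ∀ᶠ r in 𝓝 q, flux P f r = flux P' f' r := by
    filter_upwards [hm, hf.eventually_nhds] with r hr hr'
    ext i
    simp only [flux, hr, EventuallyEq.fderiv_eq hr']
  rw [coordLaplacian_eq, coordLaplacian_eq, hm.self_of_nhds]
  congr 1
  refine Finset.sum_congr rfl fun i _ ↦ ?_
  congr 1
  exact Filter.EventuallyEq.fderiv_eq (hfl.mono fun r hr ↦ congrFun hr i)

theorem trace_eq_sum_repr (A : Euc n × ℝ →ₗ[ℝ] Euc n × ℝ) :
    LinearMap.trace ℝ (Euc n × ℝ) A =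
      ∑ i, (coordBasis n).repr (A (coordFrame i)) i := by
  rw [LinearMap.trace_eq_matrix_trace ℝ (coordBasis n), Matrix.trace]
  simp [LinearMap.toMatrix_apply]

/-- The vector field with given components in the coordinate frame. -/
def ofComponents (n : ℕ) : (Fin n ⊕ Unit → ℝ) ≃L[ℝ] Euc n × ℝ :=
  ((coordBasis n).equivFun.symm).toContinuousLinearEquiv

theorem repr_ofComponents (v : Fin n ⊕ Unit → ℝ) (i : Fin n ⊕ Unit) :
    (coordBasis n).repr (ofComponents n v) i = v i := by
  exact congrFun ((coordBasis n).equivFun.apply_symm_apply v) i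

/-- The `i`-th coordinate as a continuous linear functional. -/
def coordCLM (i : Fin n ⊕ Unit) : Euc n × ℝ →L[ℝ] ℝ :=
  LinearMap.toContinuousLinearMap ((coordBasis n).coord i)

/-- The field `√(det G) ∇f` is pulled back as a vector density under a change of coordinates. -/
theorem flux_comp {P' : Euc n × ℝ → Euc (n + 1)} {f' : Euc n × ℝ → ℝ}
    {T : Euc n × ℝ → Euc n × ℝ} {r : Euc n × ℝ} (hP : DifferentiableAt ℝ P' (T r))
    (hf : DifferentiableAt ℝ f' (T r)) (hT : DifferentiableAt ℝ T r)
    (hU : IsUnit (fderiv ℝ T r)) (i : Fin n ⊕ Unit) :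
    flux (P' ∘ T) (f' ∘ T) r i = coordCLM i (|(fderiv ℝ T r).det| •
      Ring.inverse (fderiv ℝ T r) (ofComponents n (flux P' f' (T r)))) := by
  classical
  have hdet : (fderiv ℝ T r).det ≠ 0 := det_ne_zero_of_isUnit hU
  obtain ⟨U, hU⟩ := hU
  set b := coordBasis n with hb
  set M := LinearMap.toMatrix b b (fderiv ℝ T r : Euc n × ℝ →ₗ[ℝ] Euc n × ℝ) with hM
  set M' := LinearMap.toMatrix b b
    (((U⁻¹ : (Euc n × ℝ →L[ℝ] Euc n × ℝ)ˣ) : Euc n × ℝ →L[ℝ] Euc n × ℝ) :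
      Euc n × ℝ →ₗ[ℝ] Euc n × ℝ) with hM'
  have hMdet : IsUnit M.det := by
    rw [hM, LinearMap.det_toMatrix]; exact hdet.isUnit
  have hinv : M⁻¹ = M' := by
    refine Matrix.inv_eq_left_inv ?_
    rw [hM, hM', ← LinearMap.toMatrix_comp, ← hU]
    have : ((((U⁻¹ : (Euc n × ℝ →L[ℝ] Euc n × ℝ)ˣ) : Euc n × ℝ →L[ℝ] Euc n × ℝ) :
      Euc n × ℝ →ₗ[ℝ] Euc n × ℝ)).comp ((U : Euc n × ℝ →L[ℝ] Euc n × ℝ) :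
      Euc n × ℝ →ₗ[ℝ] Euc n × ℝ) = LinearMap.id := by
      refine LinearMap.ext fun x ↦ ?_
      exact congrArg (fun L : Euc n × ℝ →L[ℝ] Euc n × ℝ ↦ L x) U.inv_mul
    rw [this, LinearMap.toMatrix_id]
  have hG : metricMatrix (P' ∘ T) r = M.transpose * metricMatrix P' (T r) * M := by
    rw [metricMatrix_eq_gram, metricMatrix_eq_gram, fderiv_comp r hP hT, gram_comp]
  have hs : √(metricMatrix (P' ∘ T) r).det =
      |(fderiv ℝ T r).det| * √(metricMatrix P' (T r)).det := by
    rw [metricMatrix_eq_gram, metricMatrix_eq_gram, fderiv_comp r hP hT, sqrt_det_gram_comp]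
  have hd : dcoord (f' ∘ T) r = M.transpose.mulVec (dcoord f' (T r)) := by
    ext j
    simp only [dcoord, fderiv_comp r hf hT, ContinuousLinearMap.comp_apply, Matrix.mulVec,
      dotProduct, Matrix.transpose_apply]
    conv_lhs => rw [← b.sum_repr (fderiv ℝ T r (coordFrame j))]
    rw [map_sum]
    refine Finset.sum_congr rfl fun k _ ↦ ?_
    simp [hM, LinearMap.toMatrix_apply, hb]
  have hMt : IsUnit M.transpose.det := by rwa [Matrix.det_transpose]
  rw [flux_eq_mulVec, hG, ← hG, hs, hG, hd, Matrix.mul_inv_rev, Matrix.mul_inv_rev,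
    Matrix.mulVec_mulVec, Matrix.mul_assoc, Matrix.mul_assoc, Matrix.nonsing_inv_mul _ hMt,
    Matrix.mul_one, ← Matrix.mulVec_mulVec, mul_smul, ← Matrix.mulVec_smul, ← flux_eq_mulVec,
    hinv, map_smul]
  simp only [Pi.smul_apply]
  congr 1
  rw [← hU, Ring.inverse_unit]
  change _ = b.repr _ i
  have := LinearMap.toMatrix_mulVec_repr b b
    ((((U⁻¹ : (Euc n × ℝ →L[ℝ] Euc n × ℝ)ˣ) : Euc n × ℝ →L[ℝ] Euc n × ℝ) :
      Euc n × ℝ →ₗ[ℝ] Euc n × ℝ)) (ofComponents n (flux P' f' (T r)))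
  rw [show ((b.repr (ofComponents n (flux P' f' (T r))) : Fin n ⊕ Unit → ℝ)) = flux P' f' (T r)
    from funext fun i ↦ repr_ofComponents _ i] at this
  exact congrFun this i

/-- Coordinate invariance of the Laplace–Beltrami operator, from the Piola identity for the field
`√(det G) ∇f`. -/
theorem coordLaplacian_comp {P P' : Euc n × ℝ → Euc (n + 1)} {f f' : Euc n × ℝ → ℝ}
    {T : Euc n × ℝ → Euc n × ℝ} {q : Euc n × ℝ} (hT : ContDiffAt ℝ ∞ T q)
    (hU : IsUnit (fderiv ℝ T q)) (hP' : ContDiffAt ℝ ∞ P' (T q))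
    (hf' : ContDiffAt ℝ ∞ f' (T q)) (h0 : (metricMatrix P' (T q)).det ≠ 0)
    (hP : P =ᶠ[𝓝 q] P' ∘ T) (hf : f =ᶠ[𝓝 q] f' ∘ T) :
    coordLaplacian P f q = coordLaplacian P' f' (T q) := by
  rw [coordLaplacian_congr hP hf]
  have hTd : DifferentiableAt ℝ T q := hT.differentiableAt (by simp)
  have hev : ∀ᶠ r in 𝓝 q, DifferentiableAt ℝ P' (T r) ∧ DifferentiableAt ℝ f' (T r) ∧
      DifferentiableAt ℝ T r ∧ IsUnit (fderiv ℝ T r) := by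
    have e1 := eventually_differentiableAt hP'
    have e2 := eventually_differentiableAt hf'
    have e3 := eventually_differentiableAt hT
    have hc : ContinuousAt (fun r ↦ (fderiv ℝ T r).det) q :=
      ContinuousLinearMap.continuous_det.continuousAt.comp
        (hT.fderiv_right (m := ∞) (by simp)).continuousAt
    have e4 := hc.eventually_ne (det_ne_zero_of_isUnit hU)
    filter_upwards [hTd.continuousAt.eventually e1, hTd.continuousAt.eventually e2, e3, e4]
      with r h1 h2 h3 h4
    exact ⟨h1, h2, h3, isUnit_of_det_ne_zero h4⟩
  set V : Euc n × ℝ → Euc n × ℝ := fun p ↦ ofComponents n (flux P' f' p) with hV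
  have hfl : DifferentiableAt ℝ (flux P' f') (T q) :=
    differentiableAt_pi.2 fun i ↦ differentiableAt_flux hP' hf' h0 i
  have hVd : DifferentiableAt ℝ V (T q) :=
    (ofComponents n).differentiableAt.comp (T q) hfl
  obtain ⟨A, hA, htr⟩ := piola (hT.of_le (by norm_cast)) hU hVd
  have hdiv : ∀ i, fderiv ℝ (fun r ↦ flux (P' ∘ T) (f' ∘ T) r i) q = (coordCLM i).comp A :=
    fun i ↦ by
    have h1 : (fun r ↦ flux (P' ∘ T) (f' ∘ T) r i) =ᶠ[𝓝 q] fun r ↦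
        coordCLM i (|(fderiv ℝ T r).det| • Ring.inverse (fderiv ℝ T r) (V (T r))) := by
      filter_upwards [hev] with r hr
      exact flux_comp hr.1 hr.2.1 hr.2.2.1 hr.2.2.2 i
    rw [h1.fderiv_eq]
    exact ((coordCLM i).hasFDerivAt.comp q hA).fderiv
  have hdiv' : ∀ i, fderiv ℝ (fun r ↦ flux P' f' r i) (T q) =
      (coordCLM i).comp (fderiv ℝ V (T q)) := fun i ↦ by
    have h1 : (fun r ↦ flux P' f' r i) = fun r ↦ coordCLM i (V r) :=
      funext fun r ↦ (repr_ofComponents _ i).symm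
    rw [h1]
    exact ((coordCLM i).hasFDerivAt.comp (T q) hVd.hasFDerivAt).fderiv
  have hs : √(metricMatrix (P' ∘ T) q).det =
      |(fderiv ℝ T q).det| * √(metricMatrix P' (T q)).det := by
    have := hev.self_of_nhds
    rw [metricMatrix_eq_gram, metricMatrix_eq_gram, fderiv_comp q this.1 hTd, sqrt_det_gram_comp]
  rw [trace_eq_sum_repr, trace_eq_sum_repr] at htr
  rw [coordLaplacian_eq, coordLaplacian_eq, hs]
  simp only [hdiv, hdiv']
  have hd0 : |(fderiv ℝ T q).det| ≠ 0 := abs_ne_zero.2 (det_ne_zero_of_isUnit hU)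
  have h3 : ∑ i, ((coordCLM i).comp A) (coordFrame i) = |(fderiv ℝ T q).det| *
      ∑ i, ((coordCLM i).comp (fderiv ℝ V (T q))) (coordFrame i) := htr
  rw [h3]
  field_simp

theorem coordLaplacian_sum {ι : Type*} (s : Finset ι) {P : Euc n × ℝ → Euc (n + 1)}
    {f : ι → Euc n × ℝ → ℝ} {q : Euc n × ℝ} (hP : ContDiffAt ℝ ∞ P q)
    (hf : ∀ k ∈ s, ContDiffAt ℝ ∞ (f k) q) (h0 : (metricMatrix P q).det ≠ 0) :
    coordLaplacian P (fun r ↦ ∑ k ∈ s, f k r) q = ∑ k ∈ s, coordLaplacian P (f k) q := by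
  have hev : ∀ᶠ r in 𝓝 q, ∀ k ∈ s, DifferentiableAt ℝ (f k) r := by
    rw [Filter.eventually_all_finset]
    intro k hk
    exact eventually_differentiableAt (hf k hk)
  have hfl : ∀ i, fderiv ℝ (fun r ↦ flux P (fun r ↦ ∑ k ∈ s, f k r) r i) q =
      ∑ k ∈ s, fderiv ℝ (fun r ↦ flux P (f k) r i) q := fun i ↦ by
    rw [← fderiv_fun_sum fun k hk ↦ differentiableAt_flux hP (hf k hk) h0 i]
    refine Filter.EventuallyEq.fderiv_eq ?_
    filter_upwards [hev] with r hr
    simp only [flux, fderiv_fun_sum hr, _root_.sum_apply, Finset.mul_sum]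
    exact Finset.sum_comm
  simp only [coordLaplacian_eq, hfl, _root_.sum_apply]
  rw [Finset.sum_comm, Finset.mul_sum]

/-- The product rule `Δ(f ^ 2) = 2 f Δf + 2 |∇f| ^ 2`. -/
theorem coordLaplacian_sq {P : Euc n × ℝ → Euc (n + 1)}
    {f : Euc n × ℝ → ℝ} {q : Euc n × ℝ} (hP : ContDiffAt ℝ ∞ P q)
    (hf : ContDiffAt ℝ ∞ f q) (hL : Function.Injective (fderiv ℝ P q)) :
    coordLaplacian P (fun r ↦ f r ^ 2) q = 2 * (f q * coordLaplacian P f q) +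
      2 * (dcoord f q ⬝ᵥ (metricMatrix P q)⁻¹.mulVec (dcoord f q)) := by
  have h0 : (metricMatrix P q).det ≠ 0 := (det_gram_pos hL).ne'
  have hs : √(metricMatrix P q).det ≠ 0 := (Real.sqrt_pos.2 (det_gram_pos hL)).ne'
  have hfl : ∀ i, fderiv ℝ (fun r ↦ flux P (fun r ↦ f r ^ 2) r i) q (coordFrame i) =
      2 * (f q * fderiv ℝ (fun r ↦ flux P f r i) q (coordFrame i)) +
        2 * (flux P f q i * dcoord f q i) := fun i ↦ by
    have h1 : (fun r ↦ flux P (fun r ↦ f r ^ 2) r i) =ᶠ[𝓝 q] fun r ↦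
        2 * (f r * flux P f r i) := by
      filter_upwards [eventually_differentiableAt hf] with r hd
      simp only [flux, fderiv_fun_pow 2 hd, Finset.mul_sum]
      refine Finset.sum_congr rfl fun j _ ↦ ?_
      simp
      ring
    have hfd : DifferentiableAt ℝ f q := hf.differentiableAt (by simp)
    rw [h1.fderiv_eq, fderiv_const_mul (hfd.fun_mul (differentiableAt_flux hP hf h0 i)),
      fderiv_fun_mul hfd (differentiableAt_flux hP hf h0 i)]
    simp [dcoord]
  have e : ∑ i, flux P f q i * dcoord f q i = √(metricMatrix P q).det *
      (dcoord f q ⬝ᵥ (metricMatrix P q)⁻¹.mulVec (dcoord f q)) := by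
    rw [flux_eq_mulVec, dotProduct, Finset.mul_sum]
    exact Finset.sum_congr rfl fun i _ ↦ by simp; ring
  rw [coordLaplacian_eq, coordLaplacian_eq]
  simp only [hfl, Finset.sum_add_distrib, ← Finset.mul_sum]
  rw [e]
  field_simp

end Flux

/-! ### The divergence theorem in a coordinate domain -/

section Divergence

theorem integral_fderiv_eq_zero {E : Type*} [NormedAddCommGroup E] [NormedSpace ℝ E]
    [FiniteDimensional ℝ E] [MeasurableSpace E] [BorelSpace E] {μ : Measure E}
    [μ.IsAddHaarMeasure] {X : E → ℝ} (hX : ContDiff ℝ 1 X) (hc : HasCompactSupport X) (e : E) :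
    ∫ x, fderiv ℝ X x e ∂μ = 0 := by
  have h := integral_mul_fderiv_eq_neg_fderiv_mul_of_integrable (μ := μ) (f := fun _ : E ↦ (1 : ℝ))
    (g := X) (v := e) (by simp) ?_ ?_ (fun x _ ↦ differentiableAt_const _)
    (fun x _ ↦ hX.differentiable one_ne_zero x)
  · simpa using h
  · simp only [one_mul]
    exact ((hX.continuous_fderiv one_ne_zero).clm_apply
      continuous_const).integrable_of_hasCompactSupport (hc.fderiv_apply (𝕜 := ℝ) e)
  · simp only [one_mul]
    exact hX.continuous.integrable_of_hasCompactSupport hc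

/-- The integral over an open set `O` of a partial derivative of a function that vanishes off a
compact subset of `O`; the function need not be smooth, or vanish, outside `O`. -/
theorem setIntegral_fderiv_eq_zero {E : Type*} [NormedAddCommGroup E] [NormedSpace ℝ E]
    [FiniteDimensional ℝ E] [MeasurableSpace E] [BorelSpace E] {μ : Measure E}
    [μ.IsAddHaarMeasure] {X : E → ℝ} {O C : Set E} (hO : IsOpen O)
    (hX : ∀ x ∈ O, ContDiffAt ℝ 1 X x) (hC : IsCompact C) (hCO : C ⊆ O)
    (h0 : ∀ x ∈ O \ C, X x = 0) (e : E) :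
    IntegrableOn (fun x ↦ fderiv ℝ X x e) O μ ∧ ∫ x in O, fderiv ℝ X x e ∂μ = 0 := by
  set Y : E → ℝ := O.indicator X with hY
  have hYO : ∀ x ∈ O, Y =ᶠ[𝓝 x] X := fun x hx ↦ by
    filter_upwards [hO.mem_nhds hx] with y hy
    simp [hY, hy]
  have hYC : ∀ x, x ∉ C → Y x = 0 := fun x hx ↦ by
    by_cases hxO : x ∈ O
    · simp [hY, hxO, h0 x ⟨hxO, hx⟩]
    · simp [hY, hxO]
  have hY0 : ∀ x, x ∉ C → Y =ᶠ[𝓝 x] fun _ ↦ 0 := fun x hx ↦ by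
    filter_upwards [hC.isClosed.isOpen_compl.mem_nhds hx] with y hy using hYC y hy
  have hYs : ContDiff ℝ 1 Y := contDiff_iff_contDiffAt.2 fun x ↦ by
    by_cases hx : x ∈ C
    · exact (hX x (hCO hx)).congr_of_eventuallyEq (hYO x (hCO hx))
    · exact contDiffAt_const.congr_of_eventuallyEq (hY0 x hx)
  have hYc : HasCompactSupport Y := HasCompactSupport.intro hC hYC
  have hcongr : EqOn (fun x ↦ fderiv ℝ Y x e) (fun x ↦ fderiv ℝ X x e) O := fun x hx ↦ by
    simp only [(hYO x hx).fderiv_eq]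
  constructor
  · refine IntegrableOn.congr_fun (Integrable.integrableOn ?_) hcongr hO.measurableSet
    exact ((hYs.continuous_fderiv one_ne_zero).clm_apply
      continuous_const).integrable_of_hasCompactSupport (hYc.fderiv_apply (𝕜 := ℝ) e)
  · rw [← integral_fderiv_eq_zero (μ := μ) hYs hYc e,
      ← setIntegral_congr_fun hO.measurableSet hcongr]
    refine setIntegral_eq_integral_of_forall_compl_eq_zero fun x hx ↦ ?_
    rw [(hY0 x fun h ↦ hx (hCO h)).fderiv_eq]
    simp

/-- The weight `√(det G)` turns the Laplacian into the divergence of the flux. -/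
theorem setIntegral_sqrt_det_mul_coordLaplacian_eq_zero {n : ℕ} {P : Euc n × ℝ → Euc (n + 1)}
    {f : Euc n × ℝ → ℝ} {O C : Set (Euc n × ℝ)} (hO : IsOpen O)
    (hP : ∀ q ∈ O, ContDiffAt ℝ ∞ P q) (hf : ∀ q ∈ O, ContDiffAt ℝ ∞ f q)
    (hdet : ∀ q ∈ O, (metricMatrix P q).det ≠ 0) (hC : IsCompact C) (hCO : C ⊆ O)
    (h0 : ∀ q ∈ O \ C, f q = 0) :
    ∫ q in O, √(metricMatrix P q).det * coordLaplacian P f q = 0 := by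
  have hfl0 : ∀ i, ∀ q ∈ O \ C, flux P f q i = 0 := fun i q hq ↦ by
    have h1 : f =ᶠ[𝓝 q] fun _ ↦ 0 := by
      filter_upwards [(hO.sdiff hC.isClosed).mem_nhds hq] with r hr using h0 r hr
    simp [flux, h1.fderiv_eq]
  have : (volume : Measure (Euc n × ℝ)).IsAddHaarMeasure := by
    rw [Measure.volume_eq_prod]; infer_instance
  have key := fun i ↦ setIntegral_fderiv_eq_zero (μ := (volume : Measure (Euc n × ℝ))) hO
    (fun q hq ↦ (contDiffAt_flux (hP q hq) (hf q hq) (hdet q hq) i).of_le (by simp)) hC hCO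
    (hfl0 i) (coordFrame i)
  have hcongr : EqOn (fun q ↦ √(metricMatrix P q).det * coordLaplacian P f q)
      (fun q ↦ ∑ i, fderiv ℝ (fun r ↦ flux P f r i) q (coordFrame i)) O := fun q hq ↦ by
    have h1 : √(metricMatrix P q).det ≠ 0 := by
      have := hdet q hq
      rw [metricMatrix_eq_gram, det_gram] at this
      rw [metricMatrix_eq_gram, sqrt_det_gram]
      simpa using this
    simp only [coordLaplacian_eq]
    rw [mul_inv_cancel_left₀ h1]
  rw [setIntegral_congr_fun hO.measurableSet hcongr,
    integral_finsetSum _ fun i _ ↦ (key i).1]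
  exact Finset.sum_eq_zero fun i _ ↦ (key i).2

end Divergence

/-! ### The differential of the layer map -/

section Geometry

variable {n : ℕ} {S : Type*} [TopologicalSpace S] [ChartedSpace (Euc n) S]

theorem contMDiffAt_symm_of_mem_atlas [IsManifold (𝓡 n) ∞ S]
    {φ : OpenPartialHomeomorph S (Euc n)} (hφ : φ ∈ atlas (Euc n) S) {q : Euc n}
    (hq : q ∈ φ.target) : ContMDiffAt (𝓡 n) (𝓡 n) ∞ φ.symm q :=
  (contMDiffOn_symm_of_mem_maximalAtlas
    (IsManifold.subset_maximalAtlas hφ)).contMDiffAt (φ.open_target.mem_nhds hq)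

theorem contMDiffAt_of_mem_atlas [IsManifold (𝓡 n) ∞ S]
    {φ : OpenPartialHomeomorph S (Euc n)} (hφ : φ ∈ atlas (Euc n) S) {x : S}
    (hx : x ∈ φ.source) : ContMDiffAt (𝓡 n) (𝓡 n) ∞ φ x :=
  (contMDiffOn_of_mem_maximalAtlas
    (IsManifold.subset_maximalAtlas hφ)).contMDiffAt (φ.open_source.mem_nhds hx)

theorem contDiffAt_comp_symm [IsManifold (𝓡 n) ∞ S] {Y : Type*} [NormedAddCommGroup Y]
    [NormedSpace ℝ Y] {F : S → Y} (hF : ContMDiff (𝓡 n) 𝓘(ℝ, Y) ∞ F)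
    {φ : OpenPartialHomeomorph S (Euc n)} (hφ : φ ∈ atlas (Euc n) S) {q : Euc n}
    (hq : q ∈ φ.target) : ContDiffAt ℝ ∞ (F ∘ φ.symm) q :=
  contMDiffAt_iff_contDiffAt.1 (hF.contMDiffAt.comp q (contMDiffAt_symm_of_mem_atlas hφ hq))

theorem fderiv_comp_symm [IsManifold (𝓡 n) ∞ S] {F : S → Euc (n + 1)}
    (hF : ContMDiff (𝓡 n) 𝓘(ℝ, Euc (n + 1)) ∞ F)
    {φ : OpenPartialHomeomorph S (Euc n)} (hφ : φ ∈ atlas (Euc n) S) {q : Euc n}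
    (hq : q ∈ φ.target) (w : Euc n) :
    fderiv ℝ (F ∘ φ.symm) q w =
      differential F (φ.symm q) (mfderiv (𝓡 n) (𝓡 n) φ.symm q w) := by
  have h1 : MDifferentiableAt (𝓡 n) 𝓘(ℝ, Euc (n + 1)) F (φ.symm q) :=
    hF.contMDiffAt.mdifferentiableAt (by simp)
  have h2 : MDifferentiableAt (𝓡 n) (𝓡 n) φ.symm q :=
    (contMDiffAt_symm_of_mem_atlas hφ hq).mdifferentiableAt (by simp)
  rw [← mfderiv_eq_fderiv, mfderiv_comp q h1 h2]
  rfl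

theorem mfderiv_symm_injective [IsManifold (𝓡 n) ∞ S]
    {φ : OpenPartialHomeomorph S (Euc n)} (hφ : φ ∈ atlas (Euc n) S) {q : Euc n}
    (hq : q ∈ φ.target) : Function.Injective (mfderiv (𝓡 n) (𝓡 n) φ.symm q) := by
  have hm : φ.MDifferentiable (𝓡 n) (𝓡 n) := mdifferentiable_of_mem_atlas hφ
  exact hm.symm.mfderiv_injective hq

variable [RiemannianBundle (fun x : S ↦ TangentSpace (𝓡 n) x)]

theorem IsOrientedHypersurface.norm_differential {ψ N : S → Euc (n + 1)}
    (h : IsOrientedHypersurface ψ N) (x : S) (v : TangentSpace (𝓡 n) x) :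
    ‖differential ψ x v‖ = ‖v‖ := by
  have := h.isometric x v v
  rw [real_inner_self_eq_norm_sq, real_inner_self_eq_norm_sq] at this
  exact (sq_eq_sq₀ (norm_nonneg _) (norm_nonneg _)).1 this

variable [IsManifold (𝓡 n) ∞ S]

theorem IsOrientedHypersurface.injective_fderiv {ψ N : S → Euc (n + 1)}
    (h : IsOrientedHypersurface ψ N) {φ : OpenPartialHomeomorph S (Euc n)}
    (hφ : φ ∈ atlas (Euc n) S) {q : Euc n} (hq : q ∈ φ.target) :
    Function.Injective (fderiv ℝ (ψ ∘ φ.symm) q) := by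
  rw [injective_iff_map_eq_zero]
  intro w hw
  rw [fderiv_comp_symm h.contMDiff_immersion hφ hq, ← norm_eq_zero, h.norm_differential,
    norm_eq_zero] at hw
  exact mfderiv_symm_injective hφ hq (hw.trans (map_zero _).symm)

theorem IsOrientedHypersurface.inner_fderiv_immersion {ψ N : S → Euc (n + 1)}
    (h : IsOrientedHypersurface ψ N) {φ : OpenPartialHomeomorph S (Euc n)}
    (hφ : φ ∈ atlas (Euc n) S) {q : Euc n} (hq : q ∈ φ.target) (w : Euc n) :
    inner ℝ (fderiv ℝ (ψ ∘ φ.symm) q w) (N (φ.symm q)) = 0 := by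
  rw [fderiv_comp_symm h.contMDiff_immersion hφ hq]
  exact h.inner_normal _ _

/-- Differentiate `‖N‖ ^ 2 = 1`. -/
theorem IsOrientedHypersurface.inner_fderiv_normal {ψ N : S → Euc (n + 1)}
    (h : IsOrientedHypersurface ψ N) {φ : OpenPartialHomeomorph S (Euc n)}
    (hφ : φ ∈ atlas (Euc n) S) {q : Euc n} (hq : q ∈ φ.target) (w : Euc n) :
    inner ℝ (fderiv ℝ (N ∘ φ.symm) q w) (N (φ.symm q)) = 0 := by
  have hd : HasFDerivAt (N ∘ φ.symm) (fderiv ℝ (N ∘ φ.symm) q) q :=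
    ((contDiffAt_comp_symm h.contMDiff_normal hφ hq).differentiableAt (by simp)).hasFDerivAt
  have h1 := hd.norm_sq
  have h2 : (fun p ↦ ‖(N ∘ φ.symm) p‖ ^ 2) = fun _ ↦ (1 : ℝ) := by
    ext p; simp [h.norm_normal]
  rw [h2] at h1
  have h3 := congrArg (fun L : Euc n →L[ℝ] ℝ ↦ L w) (h1.unique (hasFDerivAt_const 1 q))
  simpa [real_inner_comm] using h3

/-- Every vector orthogonal to the normal is tangential, because the normal bundle has rank one. -/
theorem IsOrientedHypersurface.exists_fderiv_eq {ψ N : S → Euc (n + 1)}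
    (h : IsOrientedHypersurface ψ N) {φ : OpenPartialHomeomorph S (Euc n)}
    (hφ : φ ∈ atlas (Euc n) S) {q : Euc n} (hq : q ∈ φ.target) {y : Euc (n + 1)}
    (hy : inner ℝ y (N (φ.symm q)) = 0) : ∃ w, fderiv ℝ (ψ ∘ φ.symm) q w = y := by
  set L := fderiv ℝ (ψ ∘ φ.symm) q with hL
  have hN : N (φ.symm q) ≠ 0 := by
    rw [← norm_ne_zero_iff, h.norm_normal]; exact one_ne_zero
  have hle : LinearMap.range (L : Euc n →ₗ[ℝ] Euc (n + 1)) ≤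
      (Submodule.span ℝ {N (φ.symm q)})ᗮ := by
    rintro _ ⟨w, rfl⟩
    rw [Submodule.mem_orthogonal_singleton_iff_inner_left]
    exact h.inner_fderiv_immersion hφ hq w
  have h1 : Module.finrank ℝ (LinearMap.range (L : Euc n →ₗ[ℝ] Euc (n + 1))) = n := by
    rw [LinearMap.finrank_range_of_inj (h.injective_fderiv hφ hq)]; simp
  have h2 : Module.finrank ℝ ((Submodule.span ℝ {N (φ.symm q)})ᗮ : Submodule ℝ (Euc (n + 1))) = n :=
    haveI : Fact (Module.finrank ℝ (Euc (n + 1)) = n + 1) := ⟨by simp⟩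
    Submodule.finrank_orthogonal_span_singleton hN
  have h3 := Submodule.eq_of_le_of_finrank_eq hle (h1.trans h2.symm)
  have h4 : y ∈ (Submodule.span ℝ {N (φ.symm q)})ᗮ := by
    rwa [Submodule.mem_orthogonal_singleton_iff_inner_left]
  rw [← h3] at h4
  exact h4

/-- `‖dN w‖ ≤ ‖A‖ ‖dψ w‖`. The second fundamental form only sees the tangential part of `dN w`, but
`dN w` is tangential, so it can be tested against itself. -/
theorem IsOrientedHypersurface.norm_fderiv_normal_le {ψ N : S → Euc (n + 1)}
    (h : IsOrientedHypersurface ψ N) {φ : OpenPartialHomeomorph S (Euc n)}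
    (hφ : φ ∈ atlas (Euc n) S) {q : Euc n} (hq : q ∈ φ.target) (w : Euc n) :
    ‖fderiv ℝ (N ∘ φ.symm) q w‖ ≤
      ‖secondFundamentalForm ψ N (φ.symm q)‖ * ‖fderiv ℝ (ψ ∘ φ.symm) q w‖ := by
  obtain ⟨w', hw'⟩ := h.exists_fderiv_eq hφ hq (h.inner_fderiv_normal hφ hq w)
  set b := fderiv ℝ (N ∘ φ.symm) q w with hb
  have h1 : ‖b‖ ^ 2 ≤ ‖secondFundamentalForm ψ N (φ.symm q)‖ *
      ‖fderiv ℝ (ψ ∘ φ.symm) q w‖ * ‖b‖ := by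
    have e : ‖b‖ ^ 2 = inner ℝ b (fderiv ℝ (ψ ∘ φ.symm) q w') := by
      rw [hw', real_inner_self_eq_norm_sq]
    have e2 : ‖b‖ = ‖mfderiv (𝓡 n) (𝓡 n) φ.symm q w'‖ := by
      rw [← hw', fderiv_comp_symm h.contMDiff_immersion hφ hq, h.norm_differential]
    have e3 : ‖fderiv ℝ (ψ ∘ φ.symm) q w‖ = ‖mfderiv (𝓡 n) (𝓡 n) φ.symm q w‖ := by
      rw [fderiv_comp_symm h.contMDiff_immersion hφ hq, h.norm_differential]
    rw [e, e2, e3, hb, fderiv_comp_symm h.contMDiff_immersion hφ hq,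
      fderiv_comp_symm h.contMDiff_normal hφ hq, ← neg_neg (inner ℝ _ _),
      ← inner_secondFundamentalForm]
    refine (neg_le_abs _).trans ((abs_real_inner_le_norm _ _).trans ?_)
    exact mul_le_mul_of_nonneg_right (ContinuousLinearMap.le_opNorm _ _) (norm_nonneg _)
  rcases (norm_nonneg b).eq_or_lt with h0 | h0
  · rw [← h0]; positivity
  · rw [sq] at h1
    exact le_of_mul_le_mul_right h1 h0

theorem IsOrientedHypersurface.contDiffAt_layerMap {ψ N : S → Euc (n + 1)}
    (h : IsOrientedHypersurface ψ N) {φ : OpenPartialHomeomorph S (Euc n)}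
    (hφ : φ ∈ atlas (Euc n) S) {q : Euc n × ℝ} (hq : q.1 ∈ φ.target) :
    ContDiffAt ℝ ∞ (layerMap ψ N ∘ stdCoordSymm φ) q := by
  have h1 : ContDiffAt ℝ ∞ (fun p : Euc n × ℝ ↦ (ψ ∘ φ.symm) p.1) q :=
    (contDiffAt_comp_symm h.contMDiff_immersion hφ hq).comp q contDiffAt_fst
  have h2 : ContDiffAt ℝ ∞ (fun p : Euc n × ℝ ↦ (N ∘ φ.symm) p.1) q :=
    (contDiffAt_comp_symm h.contMDiff_normal hφ hq).comp q contDiffAt_fst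
  exact h1.add (contDiffAt_snd.smul h2)

theorem IsOrientedHypersurface.fderiv_layerMap {ψ N : S → Euc (n + 1)}
    (h : IsOrientedHypersurface ψ N) {φ : OpenPartialHomeomorph S (Euc n)}
    (hφ : φ ∈ atlas (Euc n) S) {q : Euc n × ℝ} (hq : q.1 ∈ φ.target) (v : Euc n × ℝ) :
    fderiv ℝ (layerMap ψ N ∘ stdCoordSymm φ) q v = fderiv ℝ (ψ ∘ φ.symm) q.1 v.1 +
      q.2 • fderiv ℝ (N ∘ φ.symm) q.1 v.1 + v.2 • N (φ.symm q.1) := by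
  have h1 : HasFDerivAt (fun p : Euc n × ℝ ↦ (ψ ∘ φ.symm) p.1) _ q :=
    ((contDiffAt_comp_symm h.contMDiff_immersion hφ hq).differentiableAt
      (by simp)).hasFDerivAt.comp q hasFDerivAt_fst
  have h2 : HasFDerivAt (fun p : Euc n × ℝ ↦ (N ∘ φ.symm) p.1) _ q :=
    ((contDiffAt_comp_symm h.contMDiff_normal hφ hq).differentiableAt
      (by simp)).hasFDerivAt.comp q hasFDerivAt_fst
  have h3 := h1.add ((hasFDerivAt_snd (𝕜 := ℝ) (p := q)).smul h2)
  have h4 : HasFDerivAt (layerMap ψ N ∘ stdCoordSymm φ) _ q := h3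
  rw [h4.fderiv]
  simp [add_assoc]

/-- The metric of the layer splits orthogonally into a tangential part and `du ^ 2`. -/
theorem IsOrientedHypersurface.norm_fderiv_layerMap_sq {ψ N : S → Euc (n + 1)}
    (h : IsOrientedHypersurface ψ N) {φ : OpenPartialHomeomorph S (Euc n)}
    (hφ : φ ∈ atlas (Euc n) S) {q : Euc n × ℝ} (hq : q.1 ∈ φ.target) (v : Euc n × ℝ) :
    ‖fderiv ℝ (layerMap ψ N ∘ stdCoordSymm φ) q v‖ ^ 2 = ‖fderiv ℝ (ψ ∘ φ.symm) q.1 v.1 +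
      q.2 • fderiv ℝ (N ∘ φ.symm) q.1 v.1‖ ^ 2 + v.2 ^ 2 := by
  rw [h.fderiv_layerMap hφ hq, norm_add_sq_real]
  simp [inner_add_left, inner_smul_left, inner_smul_right, h.inner_fderiv_immersion hφ hq,
    h.inner_fderiv_normal hφ hq, norm_smul, h.norm_normal]

/-- Along a normal segment with `|u| ‖A‖ ≤ δ` the metric of the layer differs from its value at
`u = 0` by factors between `(1 - δ) ^ 2` and `(1 + δ) ^ 2`. -/
theorem IsOrientedHypersurface.norm_fderiv_layerMap_bounds {ψ N : S → Euc (n + 1)}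
    (h : IsOrientedHypersurface ψ N) {φ : OpenPartialHomeomorph S (Euc n)}
    (hφ : φ ∈ atlas (Euc n) S) {q : Euc n} (hq : q ∈ φ.target) {u δ : ℝ}
    (hδ : |u| * ‖secondFundamentalForm ψ N (φ.symm q)‖ ≤ δ) (hδ1 : δ ≤ 1) (v : Euc n × ℝ) :
    (1 - δ) * ‖fderiv ℝ (layerMap ψ N ∘ stdCoordSymm φ) (q, 0) v‖ ≤
        ‖fderiv ℝ (layerMap ψ N ∘ stdCoordSymm φ) (q, u) v‖ ∧
      ‖fderiv ℝ (layerMap ψ N ∘ stdCoordSymm φ) (q, u) v‖ ≤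
        (1 + δ) * ‖fderiv ℝ (layerMap ψ N ∘ stdCoordSymm φ) (q, 0) v‖ := by
  have hδ0 : 0 ≤ δ := le_trans (by positivity) hδ
  have e1 := h.norm_fderiv_layerMap_sq hφ (q := (q, u)) hq v
  have e0 := h.norm_fderiv_layerMap_sq hφ (q := (q, 0)) hq v
  simp only [zero_smul, add_zero] at e0
  set A := fderiv ℝ (ψ ∘ φ.symm) q v.1
  set B := fderiv ℝ (N ∘ φ.symm) q v.1
  simp only at e1
  have hB : ‖u • B‖ ≤ δ * ‖A‖ := by
    rw [norm_smul, Real.norm_eq_abs]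
    calc |u| * ‖B‖ ≤ |u| * (‖secondFundamentalForm ψ N (φ.symm q)‖ * ‖A‖) :=
          mul_le_mul_of_nonneg_left (h.norm_fderiv_normal_le hφ hq v.1) (abs_nonneg _)
      _ ≤ δ * ‖A‖ := by
          rw [← mul_assoc]; exact mul_le_mul_of_nonneg_right hδ (norm_nonneg _)
  have hu : ‖A + u • B‖ ≤ (1 + δ) * ‖A‖ := by
    refine (norm_add_le _ _).trans ?_
    linarith
  have hl : (1 - δ) * ‖A‖ ≤ ‖A + u • B‖ := by
    have := norm_sub_norm_le A (-(u • B))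
    rw [sub_neg_eq_add, norm_neg] at this
    linarith
  have hA := norm_nonneg A
  constructor
  · refine le_of_sq_le_sq ?_ (norm_nonneg _)
    rw [mul_pow, e0, e1]
    have h1 := pow_le_pow_left₀ (mul_nonneg (by linarith) hA) hl 2
    have h2 : (1 - δ) ^ 2 ≤ 1 := by nlinarith
    have h3 := mul_le_mul_of_nonneg_right h2 (sq_nonneg v.2)
    rw [mul_pow] at h1
    linarith
  · refine le_of_sq_le_sq ?_ (by positivity)
    rw [mul_pow, e0, e1]
    have h1 := pow_le_pow_left₀ (norm_nonneg _) hu 2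
    have h2 : 1 ≤ (1 + δ) ^ 2 := by nlinarith
    have h3 := mul_le_mul_of_nonneg_right h2 (sq_nonneg v.2)
    rw [mul_pow] at h1
    linarith

/-- The layer map is an immersion where `|u| ‖A‖ < 1`. -/
theorem IsOrientedHypersurface.injective_fderiv_layerMap {ψ N : S → Euc (n + 1)}
    (h : IsOrientedHypersurface ψ N) {φ : OpenPartialHomeomorph S (Euc n)}
    (hφ : φ ∈ atlas (Euc n) S) {q : Euc n × ℝ} (hq : q.1 ∈ φ.target)
    (hu : |q.2| * ‖secondFundamentalForm ψ N (φ.symm q.1)‖ < 1) :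
    Function.Injective (fderiv ℝ (layerMap ψ N ∘ stdCoordSymm φ) q) := by
  rw [injective_iff_map_eq_zero]
  intro v hv
  have h1 := (h.norm_fderiv_layerMap_bounds hφ hq le_rfl hu.le v).1
  rw [hv, norm_zero] at h1
  have h2 : ‖fderiv ℝ (layerMap ψ N ∘ stdCoordSymm φ) (q.1, 0) v‖ = 0 := by
    refine le_antisymm ?_ (norm_nonneg _)
    by_contra! h3
    have := mul_pos (sub_pos.2 hu) h3
    linarith
  have h3 := h.norm_fderiv_layerMap_sq hφ (q := (q.1, 0)) hq v
  rw [h2] at h3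
  simp only [zero_smul, add_zero] at h3
  have h4 : v.2 = 0 := by nlinarith [sq_nonneg ‖fderiv ℝ (ψ ∘ φ.symm) q.1 v.1‖, sq_nonneg v.2]
  have h5 : ‖fderiv ℝ (ψ ∘ φ.symm) q.1 v.1‖ = 0 := by
    rw [h4] at h3
    nlinarith [norm_nonneg (fderiv ℝ (ψ ∘ φ.symm) q.1 v.1)]
  have h6 : v.1 = 0 := h.injective_fderiv hφ hq ((norm_eq_zero.1 h5).trans (map_zero _).symm)
  exact Prod.ext h6 h4

theorem IsOrientedHypersurface.norm_fderiv_layerMap_coordFrame {ψ N : S → Euc (n + 1)}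
    (h : IsOrientedHypersurface ψ N) {φ : OpenPartialHomeomorph S (Euc n)}
    (hφ : φ ∈ atlas (Euc n) S) {q : Euc n × ℝ} (hq : q.1 ∈ φ.target) :
    ‖fderiv ℝ (layerMap ψ N ∘ stdCoordSymm φ) q (coordFrame (Sum.inr ()))‖ = 1 := by
  rw [h.fderiv_layerMap hφ hq]
  simp [coordFrame, h.norm_normal]

/-- The density of the layer along a normal segment is comparable with its value on `S`. -/
theorem IsOrientedHypersurface.sqrt_det_bounds {ψ N : S → Euc (n + 1)}
    (h : IsOrientedHypersurface ψ N) {φ : OpenPartialHomeomorph S (Euc n)}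
    (hφ : φ ∈ atlas (Euc n) S) {q : Euc n} (hq : q ∈ φ.target) {u δ : ℝ}
    (hδ : |u| * ‖secondFundamentalForm ψ N (φ.symm q)‖ ≤ δ) (hδ1 : δ < 1) :
    (1 - δ) ^ (n + 1) * √(metricMatrix (layerMap ψ N ∘ stdCoordSymm φ) (q, 0)).det ≤
        √(metricMatrix (layerMap ψ N ∘ stdCoordSymm φ) (q, u)).det ∧
      √(metricMatrix (layerMap ψ N ∘ stdCoordSymm φ) (q, u)).det ≤
        (1 + δ) ^ (n + 1) * √(metricMatrix (layerMap ψ N ∘ stdCoordSymm φ) (q, 0)).det := by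
  have hδ0 : 0 ≤ δ := le_trans (by positivity) hδ
  have hb := h.norm_fderiv_layerMap_bounds hφ hq hδ hδ1.le
  have i0 := h.injective_fderiv_layerMap hφ (q := (q, 0)) hq (by simp)
  have i1 := h.injective_fderiv_layerMap hφ (q := (q, u)) hq (hδ.trans_lt hδ1)
  have h1δ : 0 < 1 - δ := by linarith
  constructor
  · have := sqrt_det_gram_le (L := fderiv ℝ (layerMap ψ N ∘ stdCoordSymm φ) (q, 0)) i1
      (c := (1 - δ)⁻¹) (by positivity) fun v ↦ by
        rw [inv_mul_eq_div, le_div_iff₀ h1δ, mul_comm]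
        exact (hb v).1
    rw [inv_pow, inv_mul_eq_div, le_div_iff₀ (by positivity), mul_comm] at this
    exact this
  · exact sqrt_det_gram_le i0 (by positivity) fun v ↦ (hb v).2

end Geometry

/-! ### Changes of charts -/

section Transition

variable {n : ℕ} {S : Type*} [TopologicalSpace S]

/-- The change of standard coordinates from the chart `φ` to the chart `χ`. -/
def transition (φ χ : OpenPartialHomeomorph S (Euc n)) (q : Euc n × ℝ) : Euc n × ℝ :=
  (χ (φ.symm q.1), q.2)

theorem stdCoordSymm_transition {φ χ : OpenPartialHomeomorph S (Euc n)} {q : Euc n × ℝ}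
    (hq' : φ.symm q.1 ∈ χ.source) :
    stdCoordSymm χ (transition φ χ q) = stdCoordSymm φ q := by
  simp [stdCoordSymm, transition, χ.left_inv hq']

theorem eventually_mem_source {φ χ : OpenPartialHomeomorph S (Euc n)} {q : Euc n × ℝ}
    (hq : q.1 ∈ φ.target) (hq' : φ.symm q.1 ∈ χ.source) :
    ∀ᶠ r in 𝓝 q, r.1 ∈ φ.target ∧ φ.symm r.1 ∈ χ.source := by
  have h1 := continuousAt_fst.eventually (φ.open_target.mem_nhds hq)
  have h2 : ContinuousAt (fun r : Euc n × ℝ ↦ φ.symm r.1) q :=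
    (φ.continuousAt_symm hq).comp continuousAt_fst
  exact h1.and (h2.eventually (χ.open_source.mem_nhds hq'))

theorem comp_stdCoordSymm_eventuallyEq {Y : Type*} (F : S × ℝ → Y)
    {φ χ : OpenPartialHomeomorph S (Euc n)} {q : Euc n × ℝ} (hq : q.1 ∈ φ.target)
    (hq' : φ.symm q.1 ∈ χ.source) :
    F ∘ stdCoordSymm φ =ᶠ[𝓝 q] (F ∘ stdCoordSymm χ) ∘ transition φ χ := by
  filter_upwards [eventually_mem_source hq hq'] with r hr
  simp only [Function.comp_apply, stdCoordSymm_transition hr.2]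

theorem continuousAt_stdCoordSymm {φ : OpenPartialHomeomorph S (Euc n)} {q : Euc n × ℝ}
    (hq : q.1 ∈ φ.target) : ContinuousAt (stdCoordSymm φ) q :=
  ((φ.continuousAt_symm hq).comp continuousAt_fst).prodMk continuousAt_snd

variable [ChartedSpace (Euc n) S] [IsManifold (𝓡 n) ∞ S]

theorem contDiffAt_transition {φ χ : OpenPartialHomeomorph S (Euc n)}
    (hφ : φ ∈ atlas (Euc n) S) (hχ : χ ∈ atlas (Euc n) S) {q : Euc n × ℝ} (hq : q.1 ∈ φ.target)
    (hq' : φ.symm q.1 ∈ χ.source) : ContDiffAt ℝ ∞ (transition φ χ) q := by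
  have h1 : ContDiffAt ℝ ∞ (χ ∘ φ.symm) q.1 := contMDiffAt_iff_contDiffAt.1
    ((contMDiffAt_of_mem_atlas hχ hq').comp q.1 (contMDiffAt_symm_of_mem_atlas hφ hq))
  exact (h1.comp q contDiffAt_fst).prodMk contDiffAt_snd

theorem contDiffAt_comp_stdCoordSymm {f : S × ℝ → ℝ}
    (hf : ContMDiff ((𝓡 n).prod 𝓘(ℝ, ℝ)) 𝓘(ℝ, ℝ) ∞ f) {φ : OpenPartialHomeomorph S (Euc n)}
    (hφ : φ ∈ atlas (Euc n) S) {q : Euc n × ℝ} (hq : q.1 ∈ φ.target) :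
    ContDiffAt ℝ ∞ (f ∘ stdCoordSymm φ) q := by
  have h1 : ContMDiffAt 𝓘(ℝ, Euc n × ℝ) (𝓡 n) ∞ (fun r : Euc n × ℝ ↦ φ.symm r.1) q :=
    (contMDiffAt_symm_of_mem_atlas hφ hq).comp q contDiffAt_fst.contMDiffAt
  have h2 : ContMDiffAt 𝓘(ℝ, Euc n × ℝ) 𝓘(ℝ, ℝ) ∞ (fun r : Euc n × ℝ ↦ r.2) q :=
    contDiffAt_snd.contMDiffAt
  exact contMDiffAt_iff_contDiffAt.1 (hf.contMDiffAt.comp q (h1.prodMk h2))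

variable [RiemannianBundle (fun x : S ↦ TangentSpace (𝓡 n) x)]

theorem IsOrientedHypersurface.fderiv_layerMap_transition {ψ N : S → Euc (n + 1)}
    (h : IsOrientedHypersurface ψ N) {φ χ : OpenPartialHomeomorph S (Euc n)}
    (hφ : φ ∈ atlas (Euc n) S) (hχ : χ ∈ atlas (Euc n) S) {q : Euc n × ℝ} (hq : q.1 ∈ φ.target)
    (hq' : φ.symm q.1 ∈ χ.source) :
    fderiv ℝ (layerMap ψ N ∘ stdCoordSymm φ) q =
      (fderiv ℝ (layerMap ψ N ∘ stdCoordSymm χ) (transition φ χ q)).comp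
        (fderiv ℝ (transition φ χ) q) := by
  rw [(comp_stdCoordSymm_eventuallyEq (layerMap ψ N) hq hq').fderiv_eq]
  exact fderiv_comp q ((h.contDiffAt_layerMap hχ (χ.map_source hq')).differentiableAt (by simp))
    ((contDiffAt_transition hφ hχ hq hq').differentiableAt (by simp))

theorem IsOrientedHypersurface.isUnit_fderiv_transition {ψ N : S → Euc (n + 1)}
    (h : IsOrientedHypersurface ψ N) {φ χ : OpenPartialHomeomorph S (Euc n)}
    (hφ : φ ∈ atlas (Euc n) S) (hχ : χ ∈ atlas (Euc n) S) {q : Euc n × ℝ} (hq : q.1 ∈ φ.target)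
    (hq' : φ.symm q.1 ∈ χ.source)
    (hu : |q.2| * ‖secondFundamentalForm ψ N (φ.symm q.1)‖ < 1) :
    IsUnit (fderiv ℝ (transition φ χ) q) := by
  have hinj := h.injective_fderiv_layerMap hφ hq hu
  rw [h.fderiv_layerMap_transition hφ hχ hq hq', ContinuousLinearMap.coe_comp] at hinj
  have h1 : Function.Injective (fderiv ℝ (transition φ χ) q) := hinj.of_comp
  refine isUnit_of_det_ne_zero fun h0 ↦ ?_
  have h2 := LinearMap.bot_lt_ker_of_det_eq_zero
    (f := (fderiv ℝ (transition φ χ) q : Euc n × ℝ →ₗ[ℝ] Euc n × ℝ)) h0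
  exact h2.ne' (LinearMap.ker_eq_bot.2 h1)

/-- The Laplacian of the layer can be computed in any chart, not only in the preferred one. -/
theorem IsOrientedHypersurface.layerLaplacian_eq {ψ N : S → Euc (n + 1)}
    (h : IsOrientedHypersurface ψ N) {f : S × ℝ → ℝ}
    (hf : ContMDiff ((𝓡 n).prod 𝓘(ℝ, ℝ)) 𝓘(ℝ, ℝ) ∞ f) {φ : OpenPartialHomeomorph S (Euc n)}
    (hφ : φ ∈ atlas (Euc n) S) {z : S × ℝ} (hz : z.1 ∈ φ.source)
    (hu : |z.2| * ‖secondFundamentalForm ψ N z.1‖ < 1) :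
    layerLaplacian ψ N f z = coordLaplacian (layerMap ψ N ∘ stdCoordSymm φ)
      (f ∘ stdCoordSymm φ) (φ z.1, z.2) := by
  set χ := chartAt (Euc n) z.1 with hχdef
  have hχ : χ ∈ atlas (Euc n) S := chart_mem_atlas _ _
  have hzχ : z.1 ∈ χ.source := mem_chart_source _ _
  have hinv : χ.symm (χ z.1) = z.1 := χ.left_inv hzχ
  have hq : (χ z.1, z.2).1 ∈ χ.target := χ.map_source hzχ
  have hq' : χ.symm (χ z.1, z.2).1 ∈ φ.source := by simpa [hinv] using hz
  have hT : transition χ φ (χ z.1, z.2) = (φ z.1, z.2) := by simp [transition, hinv]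
  have hTq : (transition χ φ (χ z.1, z.2)).1 ∈ φ.target := by
    rw [hT]; exact φ.map_source hz
  have hinj : Function.Injective (fderiv ℝ (layerMap ψ N ∘ stdCoordSymm φ) (φ z.1, z.2)) :=
    h.injective_fderiv_layerMap hφ (q := (φ z.1, z.2)) (φ.map_source hz)
      (by simp only; rwa [φ.left_inv hz])
  rw [← hT]
  exact coordLaplacian_comp (contDiffAt_transition hχ hφ hq hq')
    (h.isUnit_fderiv_transition hχ hφ hq hq' (by simp only; rwa [hinv]))
    (h.contDiffAt_layerMap hφ hTq) (contDiffAt_comp_stdCoordSymm hf hφ hTq)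
    (by rw [hT]; exact (det_gram_pos hinj).ne')
    (comp_stdCoordSymm_eventuallyEq _ hq hq') (comp_stdCoordSymm_eventuallyEq _ hq hq')

theorem IsOrientedHypersurface.continuousAt_layerLaplacian {ψ N : S → Euc (n + 1)}
    (h : IsOrientedHypersurface ψ N) {f : S × ℝ → ℝ}
    (hf : ContMDiff ((𝓡 n).prod 𝓘(ℝ, ℝ)) 𝓘(ℝ, ℝ) ∞ f) {a : ℝ}
    (hI : ∀ z ∈ layer S a, |z.2| * ‖secondFundamentalForm ψ N z.1‖ < 1) {z : S × ℝ}
    (hz : z ∈ layer S a) : ContinuousAt (layerLaplacian ψ N f) z := by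
  set φ := chartAt (Euc n) z.1 with hφdef
  have hφ : φ ∈ atlas (Euc n) S := chart_mem_atlas _ _
  have hzφ : z.1 ∈ φ.source := mem_chart_source _ _
  have hev : layerLaplacian ψ N f =ᶠ[𝓝 z] fun y ↦ coordLaplacian (layerMap ψ N ∘ stdCoordSymm φ)
      (f ∘ stdCoordSymm φ) (φ y.1, y.2) := by
    have h1 : IsOpen (layer S a) := isOpen_univ.prod isOpen_Ioo
    filter_upwards [h1.mem_nhds hz, continuousAt_fst.eventually (φ.open_source.mem_nhds hzφ)]
      with y hy hy'
    exact h.layerLaplacian_eq hf hφ hy' (hI y hy)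
  refine ContinuousAt.congr ?_ hev.symm
  have hinj : Function.Injective (fderiv ℝ (layerMap ψ N ∘ stdCoordSymm φ) (φ z.1, z.2)) :=
    h.injective_fderiv_layerMap hφ (q := (φ z.1, z.2)) (φ.map_source hzφ)
      (by simp only; rw [φ.left_inv hzφ]; exact hI z hz)
  have hc : ContinuousAt (fun y : S × ℝ ↦ (φ y.1, y.2)) z :=
    ((φ.continuousAt hzφ).comp continuousAt_fst).prodMk continuousAt_snd
  exact ContinuousAt.comp (f := fun y : S × ℝ ↦ (φ y.1, y.2))
    (continuousAt_coordLaplacian (h.contDiffAt_layerMap hφ (φ.map_source hzφ))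
      (contDiffAt_comp_stdCoordSymm hf hφ (φ.map_source hzφ)) (det_gram_pos hinj).ne') hc

end Transition

/-! ### The Riemannian measure of the layer -/

section CoordDomain

variable {n : ℕ} {S : Type*} [TopologicalSpace S]

/-- The domain of the standard coordinates of the chart `φ`. -/
def coordDomain (a : ℝ) (φ : OpenPartialHomeomorph S (Euc n)) : Set (Euc n × ℝ) :=
  φ.target ×ˢ Ioo (-a) a

/-- The part of `S × ℝ` over the domain of the chart `φ`. -/
def cylinder (φ : OpenPartialHomeomorph S (Euc n)) : Set (S × ℝ) := φ.source ×ˢ univ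

theorem isOpen_coordDomain (a : ℝ) (φ : OpenPartialHomeomorph S (Euc n)) :
    IsOpen (coordDomain a φ) := φ.open_target.prod isOpen_Ioo

theorem isOpen_cylinder (φ : OpenPartialHomeomorph S (Euc n)) : IsOpen (cylinder φ) :=
  φ.open_source.prod isOpen_univ

theorem continuousOn_stdCoordSymm (a : ℝ) (φ : OpenPartialHomeomorph S (Euc n)) :
    ContinuousOn (stdCoordSymm φ) (coordDomain a φ) := fun _ hq ↦
  (continuousAt_stdCoordSymm hq.1).continuousWithinAt

theorem stdCoordSymm_mem_cylinder {a : ℝ} {φ : OpenPartialHomeomorph S (Euc n)} {q : Euc n × ℝ}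
    (hq : q ∈ coordDomain a φ) : stdCoordSymm φ q ∈ cylinder φ :=
  ⟨φ.map_target hq.1, mem_univ _⟩

theorem stdCoordSymm_mem_layer {a : ℝ} {φ : OpenPartialHomeomorph S (Euc n)} {q : Euc n × ℝ}
    (hq : q ∈ coordDomain a φ) : stdCoordSymm φ q ∈ layer S a :=
  ⟨mem_univ _, hq.2⟩

/-- Only continuity on `O` is available, so the preimage is taken inside the subtype `O`. -/
theorem measurableSet_inter_preimage {X Y : Type*} [TopologicalSpace X] [MeasurableSpace X]
    [BorelSpace X] [TopologicalSpace Y] [MeasurableSpace Y] [BorelSpace Y] {g : X → Y} {O : Set X}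
    (hg : ContinuousOn g O) (hO : MeasurableSet O) {B : Set Y} (hB : MeasurableSet B) :
    MeasurableSet (g ⁻¹' B ∩ O) := by
  have h1 : Measurable (O.domRestrict g) :=
    (continuousOn_iff_continuous_domRestrict.1 hg).measurable
  have h2 := hO.subtype_image (h1 hB)
  convert h2 using 1
  ext x
  simp [and_comm]

end CoordDomain

section Density

variable {n : ℕ} {S : Type*} [TopologicalSpace S] [ChartedSpace (Euc n) S] [IsManifold (𝓡 n) ∞ S]
  [RiemannianBundle (fun x : S ↦ TangentSpace (𝓡 n) x)]

theorem IsOrientedHypersurface.continuousAt_density {ψ N : S → Euc (n + 1)}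
    (h : IsOrientedHypersurface ψ N) {φ : OpenPartialHomeomorph S (Euc n)}
    (hφ : φ ∈ atlas (Euc n) S) {q : Euc n × ℝ} (hq : q.1 ∈ φ.target) :
    ContinuousAt (fun r ↦ √(metricMatrix (layerMap ψ N ∘ stdCoordSymm φ) r).det) q :=
  (contDiffAt_det (contDiffAt_metricMatrix (h.contDiffAt_layerMap hφ hq))).continuousAt.sqrt

theorem IsOrientedHypersurface.aemeasurable_density {ψ N : S → Euc (n + 1)}
    (h : IsOrientedHypersurface ψ N) {φ : OpenPartialHomeomorph S (Euc n)}
    (hφ : φ ∈ atlas (Euc n) S) (a : ℝ) :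
    AEMeasurable (fun q ↦ ENNReal.ofReal
      √(metricMatrix (layerMap ψ N ∘ stdCoordSymm φ) q).det)
      (volume.restrict (coordDomain a φ)) := by
  have h1 : ContinuousOn (fun q ↦ √(metricMatrix (layerMap ψ N ∘ stdCoordSymm φ) q).det)
      (coordDomain a φ) := fun q hq ↦ (h.continuousAt_density hφ hq.1).continuousWithinAt
  exact (h1.aemeasurable (isOpen_coordDomain a φ).measurableSet).ennreal_ofReal

end Density

section Volume

variable {n : ℕ} {S : Type*} [TopologicalSpace S] [MeasurableSpace S] [BorelSpace S]

theorem aemeasurable_stdCoordSymm (a : ℝ) (φ : OpenPartialHomeomorph S (Euc n)) :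
    AEMeasurable (stdCoordSymm φ) (volume.restrict (coordDomain a φ)) :=
  (continuousOn_stdCoordSymm a φ).aemeasurable (isOpen_coordDomain a φ).measurableSet

theorem chartVolume_apply (ψ N : S → Euc (n + 1)) (a : ℝ) (φ : OpenPartialHomeomorph S (Euc n))
    {B : Set (S × ℝ)} (hB : MeasurableSet B) :
    chartVolume ψ N a φ B = ∫⁻ q in stdCoordSymm φ ⁻¹' B ∩ coordDomain a φ,
      ENNReal.ofReal √(metricMatrix (layerMap ψ N ∘ stdCoordSymm φ) q).det := by
  have h1 := (aemeasurable_stdCoordSymm a φ).mono_ac (withDensity_absolutelyContinuous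
    (volume.restrict (coordDomain a φ)) fun q ↦ ENNReal.ofReal
      √(metricMatrix (layerMap ψ N ∘ stdCoordSymm φ) q).det)
  have h2 : chartVolume ψ N a φ B = _ := Measure.map_apply_of_aemeasurable h1 hB
  rw [h2, withDensity_apply',
    Measure.restrict_restrict' (isOpen_coordDomain a φ).measurableSet]

theorem chartVolume_restrict_cylinder_self (ψ N : S → Euc (n + 1)) (a : ℝ)
    (φ : OpenPartialHomeomorph S (Euc n)) :
    (chartVolume ψ N a φ).restrict (cylinder φ) = chartVolume ψ N a φ := by
  ext B hB
  have hU := (isOpen_cylinder φ).measurableSet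
  rw [Measure.restrict_apply hB, chartVolume_apply _ _ _ _ (hB.inter hU),
    chartVolume_apply _ _ _ _ hB]
  congr 2
  ext q
  simp only [mem_inter_iff, mem_preimage]
  exact ⟨fun hq ↦ ⟨hq.1.1, hq.2⟩, fun hq ↦ ⟨⟨hq.1, stdCoordSymm_mem_cylinder hq.2⟩, hq.2⟩⟩

variable [ChartedSpace (Euc n) S] [IsManifold (𝓡 n) ∞ S]
  [RiemannianBundle (fun x : S ↦ TangentSpace (𝓡 n) x)]

/-- The chart volumes agree on overlaps: this is the change of variables formula. -/
theorem IsOrientedHypersurface.chartVolume_restrict_cylinder {ψ N : S → Euc (n + 1)}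
    (h : IsOrientedHypersurface ψ N) {a : ℝ}
    {φ χ : OpenPartialHomeomorph S (Euc n)} (hφ : φ ∈ atlas (Euc n) S)
    (hχ : χ ∈ atlas (Euc n) S) :
    (chartVolume ψ N a φ).restrict (cylinder χ) = (chartVolume ψ N a χ).restrict (cylinder φ) := by
  ext B hB
  have hUφ := (isOpen_cylinder φ).measurableSet
  have hUχ := (isOpen_cylinder χ).measurableSet
  rw [Measure.restrict_apply hB, Measure.restrict_apply hB,
    chartVolume_apply _ _ _ _ (hB.inter hUχ), chartVolume_apply _ _ _ _ (hB.inter hUφ)]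
  -- the transition map is a bijection of `s` onto `s'`
  set s := stdCoordSymm φ ⁻¹' (B ∩ cylinder χ) ∩ coordDomain a φ with hs
  set s' := stdCoordSymm χ ⁻¹' (B ∩ cylinder φ) ∩ coordDomain a χ with hs'
  have hmeas : MeasurableSet s := measurableSet_inter_preimage (continuousOn_stdCoordSymm a φ)
    (isOpen_coordDomain a φ).measurableSet (hB.inter hUχ)
  have hmem : ∀ {φ χ : OpenPartialHomeomorph S (Euc n)} {q},
      q ∈ stdCoordSymm φ ⁻¹' (B ∩ cylinder χ) ∩ coordDomain a φ →
      transition φ χ q ∈ stdCoordSymm χ ⁻¹' (B ∩ cylinder φ) ∩ coordDomain a χ ∧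
      transition χ φ (transition φ χ q) = q := by
    intro φ χ q hq
    have h1 : q.1 ∈ φ.target := hq.2.1
    have h2 : φ.symm q.1 ∈ χ.source := hq.1.2.1
    refine ⟨⟨?_, χ.map_source h2, hq.2.2⟩, ?_⟩
    · rw [mem_preimage, stdCoordSymm_transition h2]
      exact ⟨hq.1.1, stdCoordSymm_mem_cylinder hq.2⟩
    · ext1
      · simp [transition, χ.left_inv h2, φ.right_inv h1]
      · rfl
  have himg : transition φ χ '' s = s' := by
    apply Subset.antisymm
    · rintro _ ⟨q, hq, rfl⟩
      exact (hmem hq).1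
    · intro q hq
      exact ⟨transition χ φ q, (hmem hq).1, (hmem hq).2⟩
  have hinj : InjOn (transition φ χ) s := fun q hq r hr hqr ↦ by
    rw [← (hmem hq).2, ← (hmem hr).2, hqr]
  have hd : ∀ q ∈ s, HasFDerivWithinAt (transition φ χ) (fderiv ℝ (transition φ χ) q) s q :=
    fun q hq ↦ ((contDiffAt_transition hφ hχ hq.2.1 hq.1.2.1).differentiableAt
      (by simp)).hasFDerivAt.hasFDerivWithinAt
  have : (volume : Measure (Euc n × ℝ)).IsAddHaarMeasure := by
    rw [Measure.volume_eq_prod]; infer_instance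
  rw [← himg, lintegral_image_eq_lintegral_abs_det_fderiv_mul volume hmeas hd hinj]
  refine setLIntegral_congr_fun hmeas fun q hq ↦ ?_
  rw [← ENNReal.ofReal_mul (abs_nonneg _), metricMatrix_eq_gram, metricMatrix_eq_gram,
    h.fderiv_layerMap_transition hφ hχ hq.2.1 hq.1.2.1, sqrt_det_gram_comp]

/-- Over the domain of a chart, the supremum that defines the Riemannian measure is the measure of
that chart. -/
theorem IsOrientedHypersurface.layerVolume_restrict_cylinder {ψ N : S → Euc (n + 1)}
    (h : IsOrientedHypersurface ψ N) {a : ℝ}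
    {φ : OpenPartialHomeomorph S (Euc n)} (hφ : φ ∈ atlas (Euc n) S) :
    (layerVolume ψ N a).restrict (cylinder φ) = chartVolume ψ N a φ := by
  have hU := (isOpen_cylinder φ).measurableSet
  apply le_antisymm
  · -- `chartVolume φ` on the cylinder and `layerVolume` off it bound all the chart volumes
    set ν := chartVolume ψ N a φ + (layerVolume ψ N a).restrict (cylinder φ)ᶜ with hν
    have hle : layerVolume ψ N a ≤ ν := by
      refine iSup₂_le fun χ hχ ↦ ?_
      rw [← Measure.restrict_add_restrict_compl (μ := chartVolume ψ N a χ) hU, hν]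
      refine add_le_add ?_ (Measure.restrict_mono le_rfl (le_iSup₂_of_le χ hχ le_rfl))
      rw [h.chartVolume_restrict_cylinder hχ hφ]
      exact Measure.restrict_le_self
    have h1 := Measure.restrict_mono (le_refl (cylinder φ)) hle
    refine h1.trans ?_
    rw [hν, Measure.restrict_add, Measure.restrict_restrict hU, inter_compl_self,
      Measure.restrict_empty, add_zero]
    exact Measure.restrict_le_self
  · rw [← chartVolume_restrict_cylinder_self]
    exact Measure.restrict_mono le_rfl (le_iSup₂_of_le φ hφ le_rfl)

theorem IsOrientedHypersurface.isLocallyFiniteMeasure_layerVolume {ψ N : S → Euc (n + 1)}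
    (h : IsOrientedHypersurface ψ N) {a : ℝ} :
    IsLocallyFiniteMeasure (layerVolume ψ N a) := by
  refine ⟨fun z ↦ ?_⟩
  set φ := chartAt (Euc n) z.1 with hφdef
  have hφ : φ ∈ atlas (Euc n) S := chart_mem_atlas _ _
  have hzφ : z.1 ∈ φ.source := mem_chart_source _ _
  obtain ⟨C, hC, hCi, hCt⟩ := exists_compact_subset φ.open_target (φ.map_source hzφ)
  set V : Set (S × ℝ) := (φ.source ∩ φ ⁻¹' interior C) ×ˢ univ with hV
  have hVo : IsOpen V := (φ.isOpen_inter_preimage isOpen_interior).prod isOpen_univ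
  have hVU : V ⊆ cylinder φ := prod_mono inter_subset_left le_rfl
  refine ⟨V, hVo.mem_nhds ⟨⟨hzφ, hCi⟩, mem_univ _⟩, ?_⟩
  have h1 : layerVolume ψ N a V = chartVolume ψ N a φ V := by
    rw [← h.layerVolume_restrict_cylinder hφ, Measure.restrict_apply hVo.measurableSet,
      inter_eq_left.2 hVU]
  rw [h1, chartVolume_apply _ _ _ _ hVo.measurableSet]
  have hK : IsCompact (C ×ˢ Icc (-a) a) := hC.prod isCompact_Icc
  have hint : IntegrableOn (fun q ↦ √(metricMatrix (layerMap ψ N ∘ stdCoordSymm φ) q).det)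
      (C ×ˢ Icc (-a) a) := by
    have hcont : ContinuousOn (fun q ↦ √(metricMatrix (layerMap ψ N ∘ stdCoordSymm φ) q).det)
        (C ×ˢ Icc (-a) a) := fun q hq ↦ (h.continuousAt_density hφ (hCt hq.1)).continuousWithinAt
    exact hcont.integrableOn_compact hK
  refine lt_of_le_of_lt (lintegral_mono_set ?_) hint.lintegral_lt_top
  rintro q ⟨hq1, hq2⟩
  have h2 := hq1.1.2
  simp only [stdCoordSymm, mem_preimage, φ.right_inv hq2.1] at h2
  exact ⟨interior_subset h2, Ioo_subset_Icc_self hq2.2⟩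

theorem IsOrientedHypersurface.integral_layerVolume_eq {ψ N : S → Euc (n + 1)}
    (h : IsOrientedHypersurface ψ N) {a : ℝ}
    {φ : OpenPartialHomeomorph S (Euc n)} (hφ : φ ∈ atlas (Euc n) S) {k : S × ℝ → ℝ}
    (hk : Continuous k) (hk0 : ∀ z, z ∉ cylinder φ → k z = 0) :
    ∫ z, k z ∂(layerVolume ψ N a) = ∫ q in coordDomain a φ,
      √(metricMatrix (layerMap ψ N ∘ stdCoordSymm φ) q).det * k (stdCoordSymm φ q) := by
  have h1 := (aemeasurable_stdCoordSymm a φ).mono_ac (withDensity_absolutelyContinuous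
    (volume.restrict (coordDomain a φ)) fun q ↦ ENNReal.ofReal
      √(metricMatrix (layerMap ψ N ∘ stdCoordSymm φ) q).det)
  rw [← setIntegral_eq_integral_of_forall_compl_eq_zero hk0, h.layerVolume_restrict_cylinder hφ]
  have h2 : ∫ z, k z ∂(chartVolume ψ N a φ) = _ :=
    integral_map h1 hk.aestronglyMeasurable
  rw [h2]
  have h3 := integral_withDensity_eq_integral_toReal_smul₀ (h.aemeasurable_density hφ a)
    (Eventually.of_forall fun _ ↦ ENNReal.ofReal_lt_top) fun q ↦ k (stdCoordSymm φ q)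
  refine h3.trans ?_
  simp only [smul_eq_mul, ENNReal.toReal_ofReal (Real.sqrt_nonneg _)]

theorem IsOrientedHypersurface.integrableOn_of_integrable {ψ N : S → Euc (n + 1)}
    (h : IsOrientedHypersurface ψ N) {a : ℝ}
    {φ : OpenPartialHomeomorph S (Euc n)} (hφ : φ ∈ atlas (Euc n) S) {k : S × ℝ → ℝ}
    (hk : Integrable k (layerVolume ψ N a)) :
    IntegrableOn (fun q ↦ √(metricMatrix (layerMap ψ N ∘ stdCoordSymm φ) q).det *
      k (stdCoordSymm φ q)) (coordDomain a φ) := by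
  have h1 := (aemeasurable_stdCoordSymm a φ).mono_ac (withDensity_absolutelyContinuous
    (volume.restrict (coordDomain a φ)) fun q ↦ ENNReal.ofReal
      √(metricMatrix (layerMap ψ N ∘ stdCoordSymm φ) q).det)
  have h2 : Integrable k (chartVolume ψ N a φ) := by
    rw [← h.layerVolume_restrict_cylinder hφ]; exact hk.restrict
  have h3 := (integrable_map_measure h2.aestronglyMeasurable h1).1 h2
  have h4 := (integrable_withDensity_iff_integrable_smul₀' (h.aemeasurable_density hφ a)
    (Eventually.of_forall fun _ ↦ ENNReal.ofReal_lt_top)).1 h3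
  simp only [Function.comp_apply, smul_eq_mul, ENNReal.toReal_ofReal (Real.sqrt_nonneg _)] at h4
  exact h4

theorem IsOrientedHypersurface.integrable_layerVolume [T2Space S] {ψ N : S → Euc (n + 1)}
    (h : IsOrientedHypersurface ψ N) (a : ℝ) {k : S × ℝ → ℝ} (hk : Continuous k)
    {C : Set (S × ℝ)} (hC : IsCompact C) (h0 : ∀ z, z ∉ C → k z = 0) :
    Integrable k (layerVolume ψ N a) :=
  haveI : IsLocallyFiniteMeasure (layerVolume ψ N a) := h.isLocallyFiniteMeasure_layerVolume
  hk.integrable_of_hasCompactSupport (HasCompactSupport.intro hC h0)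

end Volume

/-! ### Localization and the normal derivative -/

section Localization

variable {n : ℕ} {S : Type*} [TopologicalSpace S] [ChartedSpace (Euc n) S]

theorem layerLaplacian_eq_zero {ψ N : S → Euc (n + 1)} {k : S × ℝ → ℝ} {z : S × ℝ}
    (hz : z ∉ tsupport k) : layerLaplacian ψ N k z = 0 := by
  set χ := chartAt (Euc n) z.1 with hχ
  have hzχ : z.1 ∈ χ.source := mem_chart_source _ _
  have hinv : stdCoordSymm χ (χ z.1, z.2) = z := by simp [stdCoordSymm, χ.left_inv hzχ]
  have h0 : k ∘ stdCoordSymm χ =ᶠ[𝓝 (χ z.1, z.2)] fun _ ↦ 0 := by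
    have h1 : ContinuousAt (stdCoordSymm χ) (χ z.1, z.2) :=
      continuousAt_stdCoordSymm (χ.map_source hzχ)
    rw [ContinuousAt, hinv] at h1
    filter_upwards [h1.eventually ((isClosed_tsupport k).isOpen_compl.mem_nhds hz)] with q hq
    exact image_eq_zero_of_notMem_tsupport (f := k) hq
  change coordLaplacian _ _ _ = 0
  rw [coordLaplacian_congr EventuallyEq.rfl h0]
  simp [coordLaplacian]

theorem continuous_of_continuousAt_tsupport {X : Type*} [TopologicalSpace X] {C : Set X}
    (hC : IsClosed C) {g : X → ℝ} (hg : ∀ z ∈ C, ContinuousAt g z) (h0 : ∀ z, z ∉ C → g z = 0) :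
    Continuous g := continuous_iff_continuousAt.2 fun z ↦ by
  by_cases hz : z ∈ C
  · exact hg z hz
  · have : g =ᶠ[𝓝 z] fun _ ↦ 0 := by
      filter_upwards [hC.isOpen_compl.mem_nhds hz] with y hy using h0 y hy
    exact continuousAt_const.congr this.symm

variable [IsManifold (𝓡 n) ∞ S]

theorem exists_finite_partition [T2Space S] [SigmaCompactSpace S] {C : Set S} (hC : IsCompact C) :
    ∃ (ρ : C → S → ℝ) (s : Finset C), (∀ i, ContMDiff (𝓡 n) 𝓘(ℝ, ℝ) ∞ (ρ i)) ∧
      (∀ i, tsupport (ρ i) ⊆ (chartAt (Euc n) (i : S)).source) ∧ (∀ i x, 0 ≤ ρ i x) ∧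
      ∀ x ∈ C, ∑ i ∈ s, ρ i x = 1 := by
  obtain ⟨f, hf⟩ := SmoothPartitionOfUnity.exists_isSubordinate_chartAt_source_of_isClosed (𝓡 n)
    hC.isClosed
  have hfin := f.locallyFinite.finite_nonempty_inter_compact hC
  refine ⟨fun i ↦ f i, hfin.toFinset, fun i ↦ (f i).contMDiff, hf, fun i x ↦ f.nonneg i x,
    fun x hx ↦ ?_⟩
  refine SmoothPartitionOfUnity.sum_finsupport' f x hx fun i hi ↦ ?_
  rw [SmoothPartitionOfUnity.mem_finsupport] at hi
  exact hfin.mem_toFinset.2 ⟨x, hi, hx⟩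

/-- A finite partition of unity on `S`, subordinate to charts, on the projection of the support of
`k`. The functions depend on the base point only, so that they are constants on normal segments. -/
theorem exists_finite_decomposition [T2Space S] [SigmaCompactSpace S] {k : S × ℝ → ℝ}
    (hkc : HasCompactSupport k) :
    ∃ (ρ : (Prod.fst '' tsupport k : Set S) → S → ℝ)
      (s : Finset (Prod.fst '' tsupport k : Set S)),
      (∀ i, ContMDiff (𝓡 n) 𝓘(ℝ, ℝ) ∞ (ρ i)) ∧
      (∀ i, tsupport (ρ i) ⊆ (chartAt (Euc n) (i : S)).source) ∧ (∀ i x, 0 ≤ ρ i x) ∧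
      ∀ z ∈ tsupport k, ∑ i ∈ s, ρ i z.1 = 1 := by
  obtain ⟨ρ, s, h1, h2, h3, h4⟩ := exists_finite_partition (n := n) (hkc.image continuous_fst)
  exact ⟨ρ, s, h1, h2, h3, fun z hz ↦ h4 _ ⟨z, hz, rfl⟩⟩

/-- The derivative `∂f/∂u` in the normal direction. -/
def vderiv (f : S × ℝ → ℝ) (z : S × ℝ) : ℝ := deriv (fun u ↦ f (z.1, u)) z.2

theorem vderiv_stdCoordSymm {f : S × ℝ → ℝ}
    (hf : ContMDiff ((𝓡 n).prod 𝓘(ℝ, ℝ)) 𝓘(ℝ, ℝ) ∞ f) {φ : OpenPartialHomeomorph S (Euc n)}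
    (hφ : φ ∈ atlas (Euc n) S) {q : Euc n × ℝ} (hq : q.1 ∈ φ.target) :
    vderiv f (stdCoordSymm φ q) = dcoord (f ∘ stdCoordSymm φ) q (Sum.inr ()) := by
  have h1 : HasFDerivAt (f ∘ stdCoordSymm φ) (fderiv ℝ (f ∘ stdCoordSymm φ) q) (q.1, q.2) :=
    ((contDiffAt_comp_stdCoordSymm hf hφ hq).differentiableAt (by simp)).hasFDerivAt
  have h2 : HasDerivAt (fun u : ℝ ↦ (q.1, u)) ((0 : Euc n), (1 : ℝ)) q.2 :=
    (hasDerivAt_const q.2 q.1).prodMk (hasDerivAt_id q.2)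
  exact (h1.comp_hasDerivAt q.2 h2).deriv

theorem vderiv_eq_zero {f : S × ℝ → ℝ} {z : S × ℝ} (hz : z ∉ tsupport f) : vderiv f z = 0 := by
  have h1 : (fun u ↦ f (z.1, u)) =ᶠ[𝓝 z.2] fun _ ↦ 0 := by
    have h2 : ContinuousAt (fun u : ℝ ↦ (z.1, u)) z.2 := by fun_prop
    filter_upwards [h2.eventually ((isClosed_tsupport f).isOpen_compl.mem_nhds hz)] with u hu
    exact image_eq_zero_of_notMem_tsupport hu
  rw [vderiv, h1.deriv_eq]
  simp

theorem continuous_vderiv {f : S × ℝ → ℝ}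
    (hf : ContMDiff ((𝓡 n).prod 𝓘(ℝ, ℝ)) 𝓘(ℝ, ℝ) ∞ f) : Continuous (vderiv f) := by
  refine continuous_iff_continuousAt.2 fun z ↦ ?_
  set φ := chartAt (Euc n) z.1 with hφdef
  have hφ : φ ∈ atlas (Euc n) S := chart_mem_atlas _ _
  have hzφ : z.1 ∈ φ.source := mem_chart_source _ _
  have hev : vderiv f =ᶠ[𝓝 z] fun y ↦
      dcoord (f ∘ stdCoordSymm φ) (φ y.1, y.2) (Sum.inr ()) := by
    filter_upwards [continuousAt_fst.eventually (φ.open_source.mem_nhds hzφ)] with y hy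
    rw [← vderiv_stdCoordSymm hf hφ (φ.map_source hy)]
    simp [stdCoordSymm, φ.left_inv hy]
  refine ContinuousAt.congr ?_ hev.symm
  have hc : ContinuousAt (fun y : S × ℝ ↦ (φ y.1, y.2)) z :=
    ((φ.continuousAt hzφ).comp continuousAt_fst).prodMk continuousAt_snd
  have h1 : ContDiffAt ℝ ∞ (fderiv ℝ (f ∘ stdCoordSymm φ)) (φ z.1, z.2) :=
    (contDiffAt_comp_stdCoordSymm hf hφ (φ.map_source hzφ)).fderiv_right (by norm_num)
  exact ContinuousAt.comp (f := fun y : S × ℝ ↦ (φ y.1, y.2))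
    (g := fun q ↦ dcoord (f ∘ stdCoordSymm φ) q (Sum.inr ()))
    (h1.clm_apply contDiffAt_const).continuousAt hc

variable [RiemannianBundle (fun x : S ↦ TangentSpace (𝓡 n) x)]

theorem IsOrientedHypersurface.continuous_layerLaplacian {ψ N : S → Euc (n + 1)}
    (h : IsOrientedHypersurface ψ N) {a : ℝ}
    (hI : ∀ z ∈ layer S a, |z.2| * ‖secondFundamentalForm ψ N z.1‖ < 1) {k : S × ℝ → ℝ}
    (hk : ContMDiff ((𝓡 n).prod 𝓘(ℝ, ℝ)) 𝓘(ℝ, ℝ) ∞ k) (hka : tsupport k ⊆ layer S a) :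
    Continuous (layerLaplacian ψ N k) :=
  continuous_of_continuousAt_tsupport (isClosed_tsupport k)
    (fun _ hz ↦ h.continuousAt_layerLaplacian hk hI (hka hz)) fun _ hz ↦ layerLaplacian_eq_zero hz

theorem IsOrientedHypersurface.layerLaplacian_sum {ψ N : S → Euc (n + 1)}
    (h : IsOrientedHypersurface ψ N) {ι : Type*} (s : Finset ι) {k : ι → S × ℝ → ℝ}
    (hk : ∀ i, ContMDiff ((𝓡 n).prod 𝓘(ℝ, ℝ)) 𝓘(ℝ, ℝ) ∞ (k i)) {z : S × ℝ}
    (hz : |z.2| * ‖secondFundamentalForm ψ N z.1‖ < 1) :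
    layerLaplacian ψ N (fun y ↦ ∑ i ∈ s, k i y) z = ∑ i ∈ s, layerLaplacian ψ N (k i) z := by
  have hφ : chartAt (Euc n) z.1 ∈ atlas (Euc n) S := chart_mem_atlas _ _
  have hzφ : z.1 ∈ (chartAt (Euc n) z.1).source := mem_chart_source _ _
  have hinj := h.injective_fderiv_layerMap hφ (q := (chartAt (Euc n) z.1 z.1, z.2))
    (OpenPartialHomeomorph.map_source _ hzφ)
    (by simp only; rwa [OpenPartialHomeomorph.left_inv _ hzφ])
  exact coordLaplacian_sum s (h.contDiffAt_layerMap hφ (OpenPartialHomeomorph.map_source _ hzφ))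
    (fun i _ ↦ contDiffAt_comp_stdCoordSymm (hk i) hφ (OpenPartialHomeomorph.map_source _ hzφ))
    (det_gram_pos hinj).ne'

/-- The integrand of Green's formula: `|∇f| ^ 2 = Δ(f ^ 2) / 2 - f Δf`, and `|∇f| ^ 2` is at least
`(∂f/∂u) ^ 2` because `∂/∂u` is a unit vector field. -/
theorem IsOrientedHypersurface.vderiv_sq_le {ψ N : S → Euc (n + 1)}
    (h : IsOrientedHypersurface ψ N) {f : S × ℝ → ℝ}
    (hf : ContMDiff ((𝓡 n).prod 𝓘(ℝ, ℝ)) 𝓘(ℝ, ℝ) ∞ f) {z : S × ℝ}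
    (hz : |z.2| * ‖secondFundamentalForm ψ N z.1‖ < 1) :
    vderiv f z ^ 2 ≤
      2⁻¹ * layerLaplacian ψ N (fun y ↦ f y ^ 2) z - f z * layerLaplacian ψ N f z := by
  set φ := chartAt (Euc n) z.1 with hφdef
  have hφ : φ ∈ atlas (Euc n) S := chart_mem_atlas _ _
  have hzφ : z.1 ∈ φ.source := mem_chart_source _ _
  have hq : (φ z.1, z.2).1 ∈ φ.target := φ.map_source hzφ
  have hinv : stdCoordSymm φ (φ z.1, z.2) = z := by simp [stdCoordSymm, φ.left_inv hzφ]
  have hinj := h.injective_fderiv_layerMap hφ (q := (φ z.1, z.2)) hq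
    (by simp only; rwa [φ.left_inv hzφ])
  have h1 := coordLaplacian_sq (h.contDiffAt_layerMap hφ hq)
    (contDiffAt_comp_stdCoordSymm hf hφ hq) hinj
  have h2 := sq_le_dotProduct_gram_inv hinj (h.norm_fderiv_layerMap_coordFrame hφ hq)
    (dcoord (f ∘ stdCoordSymm φ) (φ z.1, z.2))
  rw [← vderiv_stdCoordSymm hf hφ hq, hinv] at h2
  have h3 : layerLaplacian ψ N (fun y ↦ f y ^ 2) z = 2 * (f z * layerLaplacian ψ N f z) +
      2 * (dcoord (f ∘ stdCoordSymm φ) (φ z.1, z.2) ⬝ᵥ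
        (metricMatrix (layerMap ψ N ∘ stdCoordSymm φ) (φ z.1, z.2))⁻¹.mulVec
          (dcoord (f ∘ stdCoordSymm φ) (φ z.1, z.2))) := by
    have h4 : (f ∘ stdCoordSymm φ) (φ z.1, z.2) = f z := congrArg f hinv
    rw [h4] at h1
    exact h1
  rw [h3]
  rw [metricMatrix_eq_gram]
  linarith

end Localization

/-! ### Green's formula and the Dirichlet energy -/

section Integrals

variable {n : ℕ} {S : Type*} [TopologicalSpace S]
  [MeasurableSpace S] [BorelSpace S] [ChartedSpace (Euc n) S] [IsManifold (𝓡 n) ∞ S]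
  [RiemannianBundle (fun x : S ↦ TangentSpace (𝓡 n) x)]

theorem IsOrientedHypersurface.integral_layerLaplacian_eq_zero_of_subset_cylinder
    {ψ N : S → Euc (n + 1)} (h : IsOrientedHypersurface ψ N) {a : ℝ}
    (hI : ∀ z ∈ layer S a, |z.2| * ‖secondFundamentalForm ψ N z.1‖ < 1) {k : S × ℝ → ℝ}
    (hk : ContMDiff ((𝓡 n).prod 𝓘(ℝ, ℝ)) 𝓘(ℝ, ℝ) ∞ k) (hkc : HasCompactSupport k)
    (hka : tsupport k ⊆ layer S a) {φ : OpenPartialHomeomorph S (Euc n)}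
    (hφ : φ ∈ atlas (Euc n) S) (hkφ : tsupport k ⊆ cylinder φ) :
    ∫ z, layerLaplacian ψ N k z ∂(layerVolume ψ N a) = 0 := by
  rw [h.integral_layerVolume_eq hφ (h.continuous_layerLaplacian hI hk hka)
    fun z hz ↦ layerLaplacian_eq_zero fun hz' ↦ hz (hkφ hz')]
  have hu : ∀ q ∈ coordDomain a φ, |q.2| * ‖secondFundamentalForm ψ N (φ.symm q.1)‖ < 1 :=
    fun q hq ↦ hI _ (stdCoordSymm_mem_layer hq)
  have hcongr : EqOn (fun q ↦ √(metricMatrix (layerMap ψ N ∘ stdCoordSymm φ) q).det *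
        layerLaplacian ψ N k (stdCoordSymm φ q))
      (fun q ↦ √(metricMatrix (layerMap ψ N ∘ stdCoordSymm φ) q).det *
        coordLaplacian (layerMap ψ N ∘ stdCoordSymm φ) (k ∘ stdCoordSymm φ) q)
      (coordDomain a φ) := fun q hq ↦ by
    simp only
    rw [h.layerLaplacian_eq hk hφ (φ.map_target hq.1) (hu q hq)]
    simp [stdCoordSymm, φ.right_inv hq.1]
  rw [setIntegral_congr_fun (isOpen_coordDomain a φ).measurableSet hcongr]
  set C : Set (Euc n × ℝ) := (fun z : S × ℝ ↦ (φ z.1, z.2)) '' tsupport k with hCdef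
  have hC : IsCompact C := by
    refine hkc.image_of_continuousOn fun z hz ↦ ContinuousAt.continuousWithinAt ?_
    exact ((φ.continuousAt (hkφ hz).1).comp continuousAt_fst).prodMk continuousAt_snd
  refine setIntegral_sqrt_det_mul_coordLaplacian_eq_zero (isOpen_coordDomain a φ)
    (fun q hq ↦ h.contDiffAt_layerMap hφ hq.1) (fun q hq ↦ contDiffAt_comp_stdCoordSymm hk hφ hq.1)
    (fun q hq ↦ (det_gram_pos (h.injective_fderiv_layerMap hφ hq.1 (hu q hq))).ne') hC ?_ ?_
  · rintro _ ⟨z, hz, rfl⟩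
    exact ⟨φ.map_source (hkφ hz).1, (hka hz).2⟩
  · intro q hq
    refine image_eq_zero_of_notMem_tsupport (f := k) fun hq' ↦ hq.2 ⟨stdCoordSymm φ q, hq', ?_⟩
    simp [stdCoordSymm, φ.right_inv hq.1.1]

/-- The denominator of the Rayleigh quotient of a test function does not vanish. -/
theorem IsOrientedHypersurface.integral_sq_pos [T2Space S] {ψ N : S → Euc (n + 1)}
    (h : IsOrientedHypersurface ψ N) {a : ℝ}
    (hI : ∀ z ∈ layer S a, |z.2| * ‖secondFundamentalForm ψ N z.1‖ < 1) {f : S × ℝ → ℝ}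
    (hf : Continuous f) (hfc : HasCompactSupport f) (hfa : tsupport f ⊆ layer S a) (hf0 : f ≠ 0) :
    0 < ∫ z, f z ^ 2 ∂(layerVolume ψ N a) := by
  have i1 : Integrable (fun z ↦ f z ^ 2) (layerVolume ψ N a) :=
    h.integrable_layerVolume a (hf.pow 2) hfc
      fun z hz ↦ by simp [image_eq_zero_of_notMem_tsupport hz]
  rw [integral_pos_iff_support_of_nonneg (fun z ↦ sq_nonneg _) i1]
  obtain ⟨z, hz⟩ := Function.ne_iff.1 hf0
  have hza : z ∈ layer S a := hfa (subset_tsupport _ hz)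
  set φ := chartAt (Euc n) z.1 with hφdef
  have hφ : φ ∈ atlas (Euc n) S := chart_mem_atlas _ _
  have hzφ : z.1 ∈ φ.source := mem_chart_source _ _
  have hinv : stdCoordSymm φ (φ z.1, z.2) = z := by simp [stdCoordSymm, φ.left_inv hzφ]
  have hB : IsOpen (Function.support fun z ↦ f z ^ 2) := (hf.pow 2).isOpen_support
  have hle : chartVolume ψ N a φ ≤ layerVolume ψ N a := le_iSup₂_of_le φ hφ le_rfl
  refine lt_of_lt_of_le ?_ (hle _)
  rw [chartVolume_apply _ _ _ _ hB.measurableSet, pos_iff_ne_zero]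
  set W := stdCoordSymm φ ⁻¹' (Function.support fun z ↦ f z ^ 2) ∩ coordDomain a φ with hW
  have hWo : IsOpen W := by
    rw [hW, inter_comm]
    exact (continuousOn_stdCoordSymm a φ).isOpen_inter_preimage (isOpen_coordDomain a φ) hB
  have hWn : W.Nonempty := ⟨(φ z.1, z.2), by
    rw [mem_preimage, hinv]; simpa using hz, φ.map_source hzφ, hza.2⟩
  have : (volume : Measure (Euc n × ℝ)).IsAddHaarMeasure := by
    rw [Measure.volume_eq_prod]; infer_instance
  intro h0
  have hae := (h.aemeasurable_density hφ a).mono_set (inter_subset_right : W ⊆ coordDomain a φ)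
  rw [lintegral_eq_zero_iff' hae, Filter.EventuallyEq, ae_restrict_iff' hWo.measurableSet] at h0
  have h1 : ∀ᵐ q ∂(volume : Measure (Euc n × ℝ)), q ∉ W := by
    filter_upwards [h0] with q hq hqW
    have h2 := hq hqW
    simp only [Pi.zero_apply, ENNReal.ofReal_eq_zero] at h2
    have h3 := det_gram_pos (h.injective_fderiv_layerMap hφ hqW.2.1
      (hI _ (stdCoordSymm_mem_layer hqW.2)))
    exact absurd (Real.sqrt_pos.2 h3) (not_lt.2 h2)
  have h2 : volume W = 0 := by
    rw [ae_iff] at h1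
    simpa using h1
  exact (hWo.measure_pos volume hWn).ne' h2

variable [T2Space S] [SigmaCompactSpace S]

/-- Green's formula: the Laplacian of a compactly supported function has integral zero. -/
theorem IsOrientedHypersurface.integral_layerLaplacian_eq_zero
    {ψ N : S → Euc (n + 1)} (h : IsOrientedHypersurface ψ N) {a : ℝ}
    (hI : ∀ z ∈ layer S a, |z.2| * ‖secondFundamentalForm ψ N z.1‖ < 1) {k : S × ℝ → ℝ}
    (hk : ContMDiff ((𝓡 n).prod 𝓘(ℝ, ℝ)) 𝓘(ℝ, ℝ) ∞ k) (hkc : HasCompactSupport k)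
    (hka : tsupport k ⊆ layer S a) :
    ∫ z, layerLaplacian ψ N k z ∂(layerVolume ψ N a) = 0 := by
  obtain ⟨ρ, s, hρs, hρt, hρ0, hρ1⟩ := exists_finite_decomposition (n := n) hkc
  set κ : (Prod.fst '' tsupport k : Set S) → S × ℝ → ℝ := fun i z ↦ ρ i z.1 * k z with hκ
  have hsum : k = fun z ↦ ∑ i ∈ s, κ i z := by
    ext z
    rw [← Finset.sum_mul]
    by_cases hz : z ∈ tsupport k
    · rw [hρ1 z hz, one_mul]
    · simp [image_eq_zero_of_notMem_tsupport hz]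
  have hκs : ∀ i, ContMDiff ((𝓡 n).prod 𝓘(ℝ, ℝ)) 𝓘(ℝ, ℝ) ∞ (κ i) := fun i ↦
    ((hρs i).comp contMDiff_fst).mul hk
  have hκt : ∀ i, tsupport (κ i) ⊆ tsupport k := fun i ↦
    closure_mono fun z hz hz' ↦ hz (by simp [hκ, hz'])
  have hκc : ∀ i, HasCompactSupport (κ i) := fun i ↦
    hkc.of_isClosed_subset (isClosed_tsupport _) (hκt i)
  have hκφ : ∀ i, tsupport (κ i) ⊆ cylinder (chartAt (Euc n) (i : S)) := fun i ↦ by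
    have h1 : tsupport (κ i) ⊆ Prod.fst ⁻¹' tsupport (ρ i) :=
      closure_minimal (fun z hz ↦ subset_tsupport _ fun hz' ↦ hz (by simp [hκ, hz']))
        ((isClosed_tsupport _).preimage continuous_fst)
    exact fun z hz ↦ ⟨hρt i (h1 hz), mem_univ _⟩
  have hL : layerLaplacian ψ N k = fun z ↦ ∑ i ∈ s, layerLaplacian ψ N (κ i) z := by
    ext z
    by_cases hz : z ∈ tsupport k
    · conv_lhs => rw [hsum]
      exact h.layerLaplacian_sum s hκs (hI z (hka hz))
    · rw [layerLaplacian_eq_zero hz]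
      exact (Finset.sum_eq_zero fun i _ ↦ layerLaplacian_eq_zero fun hz' ↦ hz (hκt i hz')).symm
  rw [hL, integral_finsetSum]
  · exact Finset.sum_eq_zero fun i _ ↦ h.integral_layerLaplacian_eq_zero_of_subset_cylinder hI
      (hκs i) (hκc i) ((hκt i).trans hka) (chart_mem_atlas _ _) (hκφ i)
  · exact fun i _ ↦ h.integrable_layerVolume a
      (h.continuous_layerLaplacian hI (hκs i) ((hκt i).trans hka)) (hκc i)
      fun z hz ↦ layerLaplacian_eq_zero hz

/-- The Dirichlet energy bounds the integral of the squared normal derivative. -/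
theorem IsOrientedHypersurface.integral_vderiv_sq_le {ψ N : S → Euc (n + 1)}
    (h : IsOrientedHypersurface ψ N) {a : ℝ}
    (hI : ∀ z ∈ layer S a, |z.2| * ‖secondFundamentalForm ψ N z.1‖ < 1) {f : S × ℝ → ℝ}
    (hf : ContMDiff ((𝓡 n).prod 𝓘(ℝ, ℝ)) 𝓘(ℝ, ℝ) ∞ f) (hfc : HasCompactSupport f)
    (hfa : tsupport f ⊆ layer S a) :
    ∫ z, vderiv f z ^ 2 ∂(layerVolume ψ N a) ≤
      -∫ z, f z * layerLaplacian ψ N f z ∂(layerVolume ψ N a) := by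
  have hf2 : ContMDiff ((𝓡 n).prod 𝓘(ℝ, ℝ)) 𝓘(ℝ, ℝ) ∞ (fun z ↦ f z ^ 2) := by
    simp only [sq]
    exact hf.mul hf
  have hf2t : tsupport (fun z ↦ f z ^ 2) ⊆ tsupport f :=
    closure_mono fun z hz hz' ↦ hz (by simp [hz'])
  have hf2c : HasCompactSupport (fun z ↦ f z ^ 2) := hasCompactSupport_sq hfc
  have hL0 := h.integral_layerLaplacian_eq_zero hI hf2 hf2c (hf2t.trans hfa)
  have i1 : Integrable (fun z ↦ vderiv f z ^ 2) (layerVolume ψ N a) :=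
    h.integrable_layerVolume a ((continuous_vderiv hf).pow 2) hfc
      fun z hz ↦ by simp [vderiv_eq_zero hz]
  have i2 : Integrable (fun z ↦ 2⁻¹ * layerLaplacian ψ N (fun y ↦ f y ^ 2) z)
      (layerVolume ψ N a) :=
    (h.integrable_layerVolume a (h.continuous_layerLaplacian hI hf2 (hf2t.trans hfa)) hf2c
      fun z hz ↦ layerLaplacian_eq_zero hz).const_mul _
  have i3 : Integrable (fun z ↦ f z * layerLaplacian ψ N f z) (layerVolume ψ N a) :=
    h.integrable_layerVolume a (hf.continuous.mul (h.continuous_layerLaplacian hI hf hfa)) hfc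
      fun z hz ↦ by simp [image_eq_zero_of_notMem_tsupport hz]
  have key := integral_mono i1 (i2.sub i3) fun z ↦ by
    by_cases hz : z ∈ tsupport f
    · exact h.vderiv_sq_le hf (hI z (hfa hz))
    · have h1 : z ∉ tsupport (fun z ↦ f z ^ 2) := fun h' ↦ hz (hf2t h')
      simp [vderiv_eq_zero hz, layerLaplacian_eq_zero h1, image_eq_zero_of_notMem_tsupport hz]
  simp only [Pi.sub_apply] at key
  rw [integral_sub i2 i3, integral_const_mul, hL0] at key
  linarith

/-- A Poincaré inequality on the normal segments in each chart integrates to one on the layer. -/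
theorem IsOrientedHypersurface.mul_integral_sq_le_integral_vderiv_sq {ψ N : S → Euc (n + 1)}
    (h : IsOrientedHypersurface ψ N) {a lam : ℝ} {f : S × ℝ → ℝ}
    (hf : ContMDiff ((𝓡 n).prod 𝓘(ℝ, ℝ)) 𝓘(ℝ, ℝ) ∞ f) (hfc : HasCompactSupport f)
    (hlam : ∀ φ ∈ atlas (Euc n) S, ∀ q ∈ φ.target,
      0 ≤ ∫ u in Ioo (-a) a, √(metricMatrix (layerMap ψ N ∘ stdCoordSymm φ) (q, u)).det *
        (vderiv f (φ.symm q, u) ^ 2 - lam * f (φ.symm q, u) ^ 2)) :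
    lam * ∫ z, f z ^ 2 ∂(layerVolume ψ N a) ≤ ∫ z, vderiv f z ^ 2 ∂(layerVolume ψ N a) := by
  obtain ⟨ρ, s, hρs, hρt, hρ0, hρ1⟩ := exists_finite_decomposition (n := n) hfc
  have hv := continuous_vderiv hf
  have i1 : Integrable (fun z ↦ vderiv f z ^ 2) (layerVolume ψ N a) :=
    h.integrable_layerVolume a (hv.pow 2) hfc fun z hz ↦ by simp [vderiv_eq_zero hz]
  have i2 : Integrable (fun z ↦ lam * f z ^ 2) (layerVolume ψ N a) :=
    (h.integrable_layerVolume a (hf.continuous.pow 2) hfc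
      fun z hz ↦ by simp [image_eq_zero_of_notMem_tsupport hz]).const_mul _
  set κ : (Prod.fst '' tsupport f : Set S) → S × ℝ → ℝ :=
    fun i z ↦ ρ i z.1 * (vderiv f z ^ 2 - lam * f z ^ 2) with hκ
  have hκc : ∀ i, Continuous (κ i) := fun i ↦
    ((hρs i).continuous.comp continuous_fst).mul
      ((hv.pow 2).sub (continuous_const.mul (hf.continuous.pow 2)))
  have hκi : ∀ i, Integrable (κ i) (layerVolume ψ N a) := fun i ↦
    h.integrable_layerVolume a (hκc i) hfc fun z hz ↦ by
      simp [hκ, vderiv_eq_zero hz, image_eq_zero_of_notMem_tsupport hz]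
  have hsum : (fun z ↦ vderiv f z ^ 2 - lam * f z ^ 2) = fun z ↦ ∑ i ∈ s, κ i z := by
    ext z
    rw [← Finset.sum_mul]
    by_cases hz : z ∈ tsupport f
    · rw [hρ1 z hz, one_mul]
    · simp [vderiv_eq_zero hz, image_eq_zero_of_notMem_tsupport hz]
  have hpos : ∀ i, 0 ≤ ∫ z, κ i z ∂(layerVolume ψ N a) := fun i ↦ by
    set φ := chartAt (Euc n) (i : S) with hφdef
    have hφ : φ ∈ atlas (Euc n) S := chart_mem_atlas _ _
    rw [h.integral_layerVolume_eq hφ (hκc i) fun z hz ↦ by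
      have : ρ i z.1 = 0 := image_eq_zero_of_notMem_tsupport
        fun h' ↦ hz ⟨hρt i h', mem_univ _⟩
      simp [hκ, this]]
    have hint := h.integrableOn_of_integrable hφ (hκi i)
    rw [Measure.volume_eq_prod] at hint ⊢
    rw [coordDomain, setIntegral_prod _ hint]
    refine setIntegral_nonneg φ.open_target.measurableSet fun q hq ↦ ?_
    have e : ∀ u, √(metricMatrix (layerMap ψ N ∘ stdCoordSymm φ) (q, u)).det *
        κ i (stdCoordSymm φ (q, u)) = ρ i (φ.symm q) *
          (√(metricMatrix (layerMap ψ N ∘ stdCoordSymm φ) (q, u)).det *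
        (vderiv f (φ.symm q, u) ^ 2 - lam * f (φ.symm q, u) ^ 2)) := fun u ↦ by
      simp only [hκ, stdCoordSymm]
      ring
    simp only [e, integral_const_mul]
    exact mul_nonneg (hρ0 _ _) (hlam φ hφ q hq)
  have key : 0 ≤ ∫ z, (vderiv f z ^ 2 - lam * f z ^ 2) ∂(layerVolume ψ N a) := by
    rw [hsum, integral_finsetSum _ fun i _ ↦ hκi i]
    exact Finset.sum_nonneg fun i _ ↦ hpos i
  rw [integral_sub i1 i2, integral_const_mul] at key
  linarith

end Integrals

/-! ### Poincaré inequalities on the normal segments -/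

section Poincare

variable {n : ℕ} {S : Type*} [TopologicalSpace S] [ChartedSpace (Euc n) S] [IsManifold (𝓡 n) ∞ S]
  [RiemannianBundle (fun x : S ↦ TangentSpace (𝓡 n) x)]

/-- If `a ‖A‖ (x) ≤ δ`, a Poincaré inequality with constant `lam₀` on the normal segment through
`x` holds for the measure of the layer with `lam₀` multiplied by `((1 - δ) / (1 + δ)) ^ (n + 1)`. -/
theorem IsOrientedHypersurface.setIntegral_vderiv_sq_nonneg {ψ N : S → Euc (n + 1)}
    (h : IsOrientedHypersurface ψ N) {a δ lam lam₀ : ℝ} {f : S × ℝ → ℝ}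
    (hf : ContMDiff ((𝓡 n).prod 𝓘(ℝ, ℝ)) 𝓘(ℝ, ℝ) ∞ f) (hfc : HasCompactSupport f)
    (hfa : tsupport f ⊆ layer S a) {φ : OpenPartialHomeomorph S (Euc n)}
    (hφ : φ ∈ atlas (Euc n) S) {q : Euc n} (hq : q ∈ φ.target) (hlam : 0 ≤ lam) (hδ1 : δ < 1)
    (hδ : a * ‖secondFundamentalForm ψ N (φ.symm q)‖ ≤ δ)
    (hle : lam * (1 + δ) ^ (n + 1) ≤ (1 - δ) ^ (n + 1) * lam₀)
    (hlam₀ : ∀ g : ℝ → ℝ, ContDiff ℝ 1 g → HasCompactSupport g →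
      tsupport g ⊆ {u | (φ.symm q, u) ∈ tsupport f} →
      lam₀ * ∫ u, g u ^ 2 ≤ ∫ u, deriv g u ^ 2) :
    0 ≤ ∫ u in Ioo (-a) a, √(metricMatrix (layerMap ψ N ∘ stdCoordSymm φ) (q, u)).det *
        (vderiv f (φ.symm q, u) ^ 2 - lam * f (φ.symm q, u) ^ 2) := by
  set w : ℝ → ℝ := fun u ↦ √(metricMatrix (layerMap ψ N ∘ stdCoordSymm φ) (q, u)).det with hw
  set g : ℝ → ℝ := fun u ↦ f (φ.symm q, u) with hg
  -- the density at the foot of the normal segment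
  set D := w 0 with hD
  have hD0 : 0 ≤ D := Real.sqrt_nonneg _
  have hgs : ContDiff ℝ 1 g := contDiff_iff_contDiffAt.2 fun u ↦
    ((contDiffAt_comp_stdCoordSymm hf hφ (q := (q, u)) hq).comp u
      (contDiffAt_const.prodMk contDiffAt_id)).of_le (by simp)
  have hgt : tsupport g ⊆ {u | (φ.symm q, u) ∈ tsupport f} :=
    tsupport_comp_subset_preimage (f := fun u : ℝ ↦ (φ.symm q, u)) f (by fun_prop)
  have hgc : HasCompactSupport g := HasCompactSupport.intro (hfc.image continuous_snd)
    fun u hu ↦ image_eq_zero_of_notMem_tsupport (f := f) fun hu' ↦ hu ⟨_, hu', rfl⟩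
  have hga : tsupport g ⊆ Ioo (-a) a := fun u hu ↦ (hfa (hgt hu)).2
  have hwc : Continuous w := continuous_iff_continuousAt.2 fun u ↦
    ContinuousAt.comp (f := fun u : ℝ ↦ (q, u)) (h.continuousAt_density hφ (q := (q, u)) hq)
      (by fun_prop)
  have hb : ∀ u ∈ Ioo (-a) a, (1 - δ) ^ (n + 1) * D ≤ w u ∧ w u ≤ (1 + δ) ^ (n + 1) * D :=
    fun u hu ↦ h.sqrt_det_bounds hφ hq (le_trans (by gcongr; exact (abs_lt.2 hu).le) hδ) hδ1
  have key := mul_setIntegral_sq_mul_le_setIntegral_deriv_sq_mul hgs hgc hga hwc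
    (mul_nonneg (pow_nonneg (by linarith) _) hD0) hlam (fun u hu ↦ (hb u hu).1)
    (fun u hu ↦ (hb u hu).2)
    (by
      have := mul_le_mul_of_nonneg_right hle hD0
      calc lam * ((1 + δ) ^ (n + 1) * D) = lam * (1 + δ) ^ (n + 1) * D := by ring
        _ ≤ (1 - δ) ^ (n + 1) * lam₀ * D := this
        _ = (1 - δ) ^ (n + 1) * D * lam₀ := by ring) (hlam₀ g hgs hgc hgt)
  have hd : Continuous (deriv g) := hgs.continuous_deriv le_rfl
  have i1 : IntegrableOn (fun u ↦ deriv g u ^ 2 * w u) (Ioo (-a) a) :=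
    (((hd.pow 2).mul hwc).continuousOn.integrableOn_Icc).mono_set Ioo_subset_Icc_self
  have i2 : IntegrableOn (fun u ↦ lam * (g u ^ 2 * w u)) (Ioo (-a) a) :=
    ((continuous_const.mul ((hgs.continuous.pow 2).mul hwc)).continuousOn.integrableOn_Icc).mono_set
      Ioo_subset_Icc_self
  have e : ∀ u, w u * (vderiv f (φ.symm q, u) ^ 2 - lam * f (φ.symm q, u) ^ 2) =
      deriv g u ^ 2 * w u - lam * (g u ^ 2 * w u) := fun u ↦ by
    simp only [vderiv, hg]
    ring
  change 0 ≤ ∫ u in Ioo (-a) a, w u * _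
  simp only [e]
  rw [integral_sub i1 i2, integral_const_mul]
  linarith

end Poincare

theorem exists_pos_lt_one_mul_pow_le {lam κ : ℝ} (hlam : lam < κ) (m : ℕ) :
    ∃ δ : ℝ, 0 < δ ∧ δ < 1 ∧ lam * (1 + δ) ^ m ≤ (1 - δ) ^ m * κ := by
  have hc : ContinuousAt (fun δ : ℝ ↦ (1 - δ) ^ m * κ - lam * (1 + δ) ^ m) 0 := by fun_prop
  have h1 : ∀ᶠ δ in 𝓝[>] (0 : ℝ), 0 < (1 - δ) ^ m * κ - lam * (1 + δ) ^ m :=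
    (hc.eventually (lt_mem_nhds (by simpa using hlam))).filter_mono nhdsWithin_le_nhds
  obtain ⟨δ, hδ, hδ0, hδ1⟩ := (h1.and (Ioo_mem_nhdsGT one_pos)).exists
  exact ⟨δ, hδ0, hδ1, by linarith⟩

theorem exists_le_div_sq {a : ℝ} (ha : 0 < a) (c : ℝ) :
    ∃ b, 0 < b ∧ b < a ∧ c ≤ (b / (a ^ 2 - b ^ 2)) ^ 2 := by
  have hc : ContinuousAt (fun b : ℝ ↦ b - (|c| + 1) * (a ^ 2 - b ^ 2)) a := by fun_prop
  have h1 : ∀ᶠ b in 𝓝[<] a, 0 < b - (|c| + 1) * (a ^ 2 - b ^ 2) :=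
    (hc.eventually (lt_mem_nhds (by simpa using ha))).filter_mono nhdsWithin_le_nhds
  obtain ⟨b, hb, hb0, hba⟩ := (h1.and (Ioo_mem_nhdsLT ha)).exists
  refine ⟨b, hb0, hba, ?_⟩
  have h2 : 0 < a ^ 2 - b ^ 2 := by nlinarith
  have h3 : |c| + 1 ≤ b / (a ^ 2 - b ^ 2) := by
    rw [le_div_iff₀ h2]; linarith
  nlinarith [le_abs_self c, abs_nonneg c]

end QuantumLayer

end

theorem theorem3p1 {n : ℕ} (hn : 1 < n)
    {S : Type*} [MetricSpace S] [CompleteSpace S] [MeasurableSpace S] [BorelSpace S]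
    [ChartedSpace (Euc n) S] [IsManifold (𝓡 n) ∞ S]
    [RiemannianBundle (fun x : S ↦ TangentSpace (𝓡 n) x)]
    [IsContMDiffRiemannianBundle (𝓡 n) ∞ (Euc n) (fun x : S ↦ TangentSpace (𝓡 n) x)]
    [IsRiemannianManifold (𝓡 n) S]
    (ψ N : S → Euc (n + 1)) (hS : QuantumLayer.IsOrientedHypersurface ψ N)
    (a : ℝ) (ha : 0 < a)
    (hA1 : ∃ C₀ : ℝ, C₀ < 1 ∧ ∀ x : S, a * ‖QuantumLayer.secondFundamentalForm ψ N x‖ < C₀)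
    (x₀ : S)
    (hA2 : Tendsto (fun x : S ↦ ‖QuantumLayer.secondFundamentalForm ψ N x‖)
      (comap (fun x : S ↦ dist x x₀) atTop) (𝓝 0)) :
    (((Real.pi / (2 * a)) ^ 2 : ℝ) : EReal) ≤ QuantumLayer.sigmaEss ψ N a := by
  have hproper : ProperSpace S := QuantumLayer.properSpace_of_isRiemannianManifold (n := n)
  obtain ⟨C₀, hC₀1, hC₀⟩ := hA1
  have hC₀0 : 0 < C₀ := lt_of_le_of_lt (by positivity) (hC₀ x₀)
  have hI : ∀ z ∈ QuantumLayer.layer S a,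
      |z.2| * ‖QuantumLayer.secondFundamentalForm ψ N z.1‖ < 1 := fun z hz ↦
    lt_of_le_of_lt (by gcongr; exact (abs_lt.2 hz.2).le) ((hC₀ z.1).trans hC₀1)
  -- nonnegative constants suffice, because the bound to be proved is positive
  suffices H : ∀ lam : ℝ, 0 ≤ lam → lam < (Real.pi / (2 * a)) ^ 2 →
      (lam : EReal) ≤ QuantumLayer.sigmaEss ψ N a by
    by_contra! hlt
    obtain ⟨r, hr1, hr2⟩ := EReal.lt_iff_exists_real_btwn.1 hlt
    have h1 := H (max r 0) (le_max_right _ _)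
      (max_lt (EReal.coe_lt_coe_iff.1 hr2) (by positivity))
    have h2 : (r : EReal) ≤ ((max r 0 : ℝ) : EReal) := EReal.coe_le_coe_iff.2 (le_max_left _ _)
    exact absurd (h2.trans h1) (not_le.2 hr1)
  -- `δ` bounds `a ‖A‖` outside the ball of radius `R`; `b` is so close to `a` that on
  -- `b < |u| < a` the crude Dirichlet inequality beats the distortion of the density in the ball
  intro lam hlam0 hlam
  obtain ⟨δ, hδ0, hδ1, hδ⟩ := QuantumLayer.exists_pos_lt_one_mul_pow_le hlam (n + 1)
  obtain ⟨b, hb0, hba, hb⟩ := QuantumLayer.exists_le_div_sq ha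
    (lam * (1 + C₀) ^ (n + 1) / (1 - C₀) ^ (n + 1))
  have hev := hA2.eventually (gt_mem_nhds (div_pos hδ0 ha))
  rw [eventually_comap] at hev
  obtain ⟨R, hR⟩ := eventually_atTop.1 hev
  set K : Set (S × ℝ) := Metric.closedBall x₀ R ×ˢ Icc (-b) b with hK
  have hKc : IsCompact K := (isCompact_closedBall x₀ R).prod isCompact_Icc
  have hKa : K ⊆ QuantumLayer.layer S a := fun z hz ↦
    ⟨mem_univ _, by linarith [hz.2.1], by linarith [hz.2.2]⟩
  refine le_trans ?_ (le_iSup_of_le K (le_iSup₂_of_le hKc hKa le_rfl))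
  refine le_iInf₂ fun f hf ↦ EReal.coe_le_coe_iff.2 ?_
  have hfa : tsupport f ⊆ QuantumLayer.layer S a := fun z hz ↦ (hf.tsupport_subset hz).1
  rw [QuantumLayer.rayleighQuotient, le_div_iff₀ (hS.integral_sq_pos hI hf.contMDiff.continuous
    hf.hasCompactSupport hfa hf.ne_zero)]
  refine le_trans ?_ (hS.integral_vderiv_sq_le hI hf.contMDiff hf.hasCompactSupport hfa)
  refine hS.mul_integral_sq_le_integral_vderiv_sq hf.contMDiff hf.hasCompactSupport
    fun φ hφ q hq ↦ ?_
  -- over the ball a test function lives where `b < |u|`; elsewhere the sharp inequality applies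
  by_cases hx : dist (φ.symm q) x₀ ≤ R
  · refine hS.setIntegral_vderiv_sq_nonneg hf.contMDiff hf.hasCompactSupport hfa hφ hq hlam0 hC₀1
      (hC₀ _).le (lam₀ := (b / (a ^ 2 - b ^ 2)) ^ 2) ?_ fun g hg hgc hgt ↦
        QuantumLayer.div_sq_mul_integral_sq_le_integral_deriv_sq hb0 hba hg hgc fun u hu ↦
          ⟨(hfa (hgt hu)).2, fun hu' ↦ (hf.tsupport_subset (hgt hu)).2 ⟨hx, hu'⟩⟩
    rw [mul_comm ((1 - C₀) ^ (n + 1)), ← div_le_iff₀ (pow_pos (by linarith) _)]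
    exact hb
  · refine hS.setIntegral_vderiv_sq_nonneg hf.contMDiff hf.hasCompactSupport hfa hφ hq hlam0 hδ1
      ?_ hδ fun g hg hgc hgt ↦
        QuantumLayer.sq_mul_integral_sq_le_integral_deriv_sq ha hg hgc fun u hu ↦ (hfa (hgt hu)).2
    have h1 := hR (dist (φ.symm q) x₀) (not_le.1 hx).le (φ.symm q) rfl
    rw [lt_div_iff₀ ha] at h1
    rw [mul_comm]
    exact h1.le
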